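/- Let $\theta>1$, let $E_\theta=\{z\in\mathbb{C}:|z-1|+|z+1|<\theta^{1/2}+\theta^{-1/2}\}$, and let $\rho(z)=|z^2-1|^{-1/2}$. The weighted Szegő space $AL_2(\partial E_\theta;\rho)$ is the Hardy–Smirnov space of all functions $f$ holomorphic in $E_\theta$ such that $\sup_{1<s<\theta}\int_{\partial E_s}|f(z)|^2|dz|<\infty$, such that $f$ has non-tangential boundary values (again denoted $f$) almost everywhere on $\partial E_\theta$ with respect to arc length, and such that $$\|f\|^2=\int_{\partial E_\theta}|f(z)|^2\rho(z)\,|dz|<\infty ,$$ with the inner product $(f,g)=\int_{\partial E_\theta}f(z)\overline{g(z)}\rho(z)\,|dz|$. Let $\mathbb{T}_0=\pi^{-1/2}$ and $\mathbb{T}_k=(2/\pi)^{1/2}\mathrm{T}_k$ for $k\ge1$, where $\mathrm{T}_k$ is the $k$-th Chebyshev polynomial of the first kind, $\mathrm{T}_k(\cos x)=\cos kx$. Then $AL_2(\partial E_\theta;|z^2-1|^{-1/2})$ is a Hilbert space, and the polynomials $$(\theta^k+\theta^{-k})^{-1/2}\,\mathbb{T}_k,\qquad k=0,1,2,\dots,$$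 form an orthonormal basis of it, i.e. they belong to it, are orthonormal, and their linear span is dense in it. -/

import Mathlib

open MeasureTheory Set Filter Topology

noncomputable section

namespace SzegoEllipse

/-- The open ellipse `{z : |z - 1| + |z + 1| < θ^{1/2} + θ^{-1/2}}` with foci `±1`. -/
def ellipse (θ : ℝ) : Set ℂ := {z | ‖z - 1‖ + ‖z + 1‖ < √θ + (√θ)⁻¹}

/-- The standard parametrization `t ↦ a cos t + i b sin t`, `0 < t ≤ 2π`, of the boundary of
the ellipse; for `1 < θ` the semiaxes are `a = (θ^{1/2} + θ^{-1/2})/2` and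
`b = (θ^{1/2} - θ^{-1/2})/2`. -/
def ellipseParam (θ t : ℝ) : ℂ :=
  (((√θ + (√θ)⁻¹) / 2 * Real.cos t : ℝ) : ℂ) +
    (((√θ - (√θ)⁻¹) / 2 * Real.sin t : ℝ) : ℂ) * Complex.I

/-- The arc length measure `|dz|` on the boundary of the ellipse. -/
def arcLength (θ : ℝ) : Measure ℂ :=
  Measure.map (ellipseParam θ)
    ((volume.restrict (Ioc 0 (2 * Real.pi))).withDensity fun t => ‖deriv (ellipseParam θ) t‖ₑ)

/-- The measure `ρ(z) |dz|` on the boundary of the ellipse. -/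
def weightedArcLength (θ : ℝ) (ρ : ℂ → ℝ) : Measure ℂ :=
  (arcLength θ).withDensity fun z => ENNReal.ofReal (ρ z)

/-- The non-tangential approach region of aperture `κ` at the point `ζ`, inside the ellipse. -/
def approachRegion (θ κ : ℝ) (ζ : ℂ) : Set ℂ :=
  {z | z ∈ ellipse θ ∧ dist z ζ < κ * Metric.infDist z (frontier (ellipse θ))}

/-- The filter of non-tangential approach to `ζ`: convergence along it is convergence
in the approach regions at `ζ` of all apertures. -/
def nonTangential (θ : ℝ) (ζ : ℂ) : Filter ℂ := ⨆ κ : ℝ, 𝓝[approachRegion θ κ ζ] ζ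

/-- The non-tangential boundary function of `f`, on the boundary of the ellipse (it is set to be
zero elsewhere, and has a meaning only at points where the non-tangential limit exists). -/
def boundaryValue (θ : ℝ) (f : ℂ → ℂ) : ℂ → ℂ :=
  (frontier (ellipse θ)).indicator fun ζ => limUnder (nonTangential θ ζ) f

/-- Membership in the weighted Szegő space of the ellipse. A function on the ellipse is
represented by its extension by zero to the plane. The function is holomorphic in the ellipse, its
square means over the smaller confocal ellipses are bounded (the Hardy-Smirnov condition), it has
non-tangential boundary values almost everywhere with respect to arc length, and the boundary
function is square integrable against `ρ(z) |dz|`. -/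
structure IsSzego (θ : ℝ) (ρ : ℂ → ℝ) (f : ℂ → ℂ) : Prop where
  eq_zero : ∀ z, z ∉ ellipse θ → f z = 0
  holomorphic : DifferentiableOn ℂ f (ellipse θ)
  bounded_means : ∃ M : ENNReal, M < ⊤ ∧
    ∀ s : ℝ, 1 < s → s < θ → ∫⁻ z, ‖f z‖ₑ ^ 2 ∂(arcLength s) ≤ M
  nonTangential_limit : ∀ᵐ ζ ∂(arcLength θ), ∃ l : ℂ, Tendsto f (nonTangential θ ζ) (𝓝 l)
  memLp : MemLp (boundaryValue θ f) 2 (weightedArcLength θ ρ)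

theorem isOpen_ellipse (θ : ℝ) : IsOpen (ellipse θ) :=
  isOpen_lt (by fun_prop) continuous_const

theorem convex_ellipse (θ : ℝ) : Convex ℝ (ellipse θ) := by
  intro x hx y hy a b ha hb hab
  have h (c : ℂ) : ‖a • x + b • y - c‖ ≤ a * ‖x - c‖ + b * ‖y - c‖ := by
    have e : a • x + b • y - c = a • (x - c) + b • (y - c) := by
      have : c = (a + b) • c := by rw [hab, one_smul]
      rw [smul_sub, smul_sub]
      nth_rewrite 1 [this]
      rw [add_smul]
      abel
    rw [e]
    refine (norm_add_le _ _).trans ?_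
    rw [norm_smul, norm_smul, Real.norm_of_nonneg ha, Real.norm_of_nonneg hb]
  have h1 := h 1
  have h2 := h (-1)
  simp only [sub_neg_eq_add] at h2
  simp only [ellipse, mem_ofPred_eq] at hx hy ⊢
  generalize √θ + (√θ)⁻¹ = K at hx hy ⊢
  have hK : K = a * K + b * K := by rw [← add_mul, hab, one_mul]
  rcases ha.lt_or_eq with ha' | ha'
  · have e1 := mul_lt_mul_of_pos_left hx ha'
    have e2 := mul_le_mul_of_nonneg_left hy.le hb
    linarith
  · have hb1 : b = 1 := by linarith
    subst hb1
    rw [← ha'] at h1 h2 ⊢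
    linarith

theorem nonTangential_neBot {θ : ℝ} {ζ : ℂ} (hζ : ζ ∈ frontier (ellipse θ)) :
    (nonTangential θ ζ).NeBot := by
  have hcl : ζ ∈ closure (ellipse θ) := frontier_subset_closure hζ
  obtain ⟨x, hx⟩ : (ellipse θ).Nonempty := closure_nonempty_iff.1 ⟨ζ, hcl⟩
  obtain ⟨r, hr, hball⟩ := Metric.isOpen_iff.1 (isOpen_ellipse θ) x hx
  set κ : ℝ := (‖x - ζ‖ + 1) / r with hκ
  suffices h : (𝓝[approachRegion θ κ ζ] ζ).NeBot from
    h.mono (le_iSup (fun κ : ℝ => 𝓝[approachRegion θ κ ζ] ζ) κ)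
  have hin : ∀ ε : ℝ, 0 < ε → ε ≤ 1 → ∀ y ∈ Metric.ball x r,
      ε • y + (1 - ε) • ζ ∈ ellipse θ := by
    intro ε hε hε1 y hy
    have := (convex_ellipse θ).combo_interior_closure_mem_interior
      (x := y) (y := ζ) (a := ε) (b := 1 - ε)
      (by rw [(isOpen_ellipse θ).interior_eq]; exact hball hy) hcl hε (by linarith) (by ring)
    rwa [(isOpen_ellipse θ).interior_eq] at this
  have hmem : ∀ ε : ℝ, 0 < ε → ε ≤ 1 → ζ + ε • (x - ζ) ∈ approachRegion θ κ ζ := by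
    intro ε hε hε1
    have hz : ζ + ε • (x - ζ) = ε • x + (1 - ε) • ζ := by
      rw [smul_sub, sub_smul, one_smul]; abel
    refine ⟨by rw [hz]; exact hin ε hε hε1 x (Metric.mem_ball_self hr), ?_⟩
    have hd : ε * r ≤ Metric.infDist (ζ + ε • (x - ζ)) (frontier (ellipse θ)) := by
      refine (Metric.le_infDist ⟨ζ, hζ⟩).2 fun w hw => ?_
      by_contra! hlt
      have hw' : w ∈ ellipse θ := by
        have e : w = ε • (x + ε⁻¹ • (w - (ζ + ε • (x - ζ)))) + (1 - ε) • ζ := by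
          rw [smul_add, smul_smul, mul_inv_cancel₀ hε.ne', one_smul, hz]; abel
        rw [e]
        refine hin ε hε hε1 _ ?_
        rw [mem_ball_iff_norm, add_sub_cancel_left, norm_smul, norm_inv, Real.norm_of_nonneg hε.le,
          ← dist_eq_norm, dist_comm, inv_mul_lt_iff₀ hε]
        exact hlt
      have : w ∉ interior (ellipse θ) := hw.2
      rw [(isOpen_ellipse θ).interior_eq] at this
      exact this hw'
    have hκ0 : 0 ≤ κ := by positivity
    calc dist (ζ + ε • (x - ζ)) ζ = ε * ‖x - ζ‖ := by
          rw [dist_eq_norm, add_sub_cancel_left, norm_smul, Real.norm_of_nonneg hε.le]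
      _ < ε * (‖x - ζ‖ + 1) := by nlinarith
      _ = κ * (ε * r) := by rw [hκ]; field_simp
      _ ≤ _ := mul_le_mul_of_nonneg_left hd hκ0
  refine mem_closure_iff_nhdsWithin_neBot.1 ?_
  have ht : Tendsto (fun ε : ℝ => ζ + ε • (x - ζ)) (𝓝[>] 0) (𝓝 ζ) := by
    have : Continuous fun ε : ℝ => ζ + ε • (x - ζ) := by fun_prop
    have h0 := this.tendsto 0
    simp only [zero_smul, add_zero] at h0
    exact h0.mono_left nhdsWithin_le_nhds
  refine mem_closure_of_tendsto ht ?_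
  filter_upwards [Ioc_mem_nhdsGT (zero_lt_one' ℝ)] with ε hε
  exact hmem ε hε.1 hε.2

theorem boundaryValue_eq {θ : ℝ} {f : ℂ → ℂ} {ζ l : ℂ} (hζ : ζ ∈ frontier (ellipse θ))
    (h : Tendsto f (nonTangential θ ζ) (𝓝 l)) : boundaryValue θ f ζ = l := by
  have := nonTangential_neBot hζ
  rw [boundaryValue, indicator_of_mem hζ]
  exact h.limUnder_eq

theorem weightedArcLength_ac (θ : ℝ) (ρ : ℂ → ℝ) : weightedArcLength θ ρ ≪ arcLength θ :=
  withDensity_absolutelyContinuous _ _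

theorem boundaryValue_zero (θ : ℝ) : boundaryValue θ 0 = 0 := by
  ext ζ
  by_cases hζ : ζ ∈ frontier (ellipse θ)
  · exact boundaryValue_eq hζ tendsto_const_nhds
  · simp [boundaryValue, hζ]

theorem boundaryValue_add {θ : ℝ} {ρ : ℂ → ℝ} {f g : ℂ → ℂ}
    (hf : ∀ᵐ ζ ∂(arcLength θ), ∃ l : ℂ, Tendsto f (nonTangential θ ζ) (𝓝 l))
    (hg : ∀ᵐ ζ ∂(arcLength θ), ∃ l : ℂ, Tendsto g (nonTangential θ ζ) (𝓝 l)) :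
    boundaryValue θ (f + g) =ᵐ[weightedArcLength θ ρ] boundaryValue θ f + boundaryValue θ g := by
  refine (weightedArcLength_ac θ ρ).ae_le ?_
  filter_upwards [hf, hg] with ζ ⟨l, hl⟩ ⟨m, hm⟩
  by_cases hζ : ζ ∈ frontier (ellipse θ)
  · rw [Pi.add_apply, boundaryValue_eq hζ hl, boundaryValue_eq hζ hm]
    exact boundaryValue_eq hζ (hl.add hm)
  · simp [boundaryValue, hζ]

theorem boundaryValue_smul {θ : ℝ} {ρ : ℂ → ℝ} (c : ℂ) {f : ℂ → ℂ}
    (hf : ∀ᵐ ζ ∂(arcLength θ), ∃ l : ℂ, Tendsto f (nonTangential θ ζ) (𝓝 l)) :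
    boundaryValue θ (c • f) =ᵐ[weightedArcLength θ ρ] c • boundaryValue θ f := by
  refine (weightedArcLength_ac θ ρ).ae_le ?_
  filter_upwards [hf] with ζ ⟨l, hl⟩
  by_cases hζ : ζ ∈ frontier (ellipse θ)
  · rw [Pi.smul_apply, boundaryValue_eq hζ hl]
    exact boundaryValue_eq hζ (hl.const_smul c)
  · simp [boundaryValue, hζ]

theorem measurableSet_ellipse (θ : ℝ) : MeasurableSet (ellipse θ) :=
  (isOpen_ellipse θ).measurableSet

theorem IsSzego.measurable {θ : ℝ} {ρ : ℂ → ℝ} {f : ℂ → ℂ} (hf : IsSzego θ ρ f) :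
    Measurable f := by
  refine measurable_of_restrict_of_restrict_compl (measurableSet_ellipse θ) ?_ ?_
  · exact (continuousOn_iff_continuous_domRestrict.1 hf.holomorphic.continuousOn).measurable
  · have : (ellipse θ)ᶜ.domRestrict f = fun _ => 0 := by
      ext z; exact hf.eq_zero z z.2
    rw [this]
    exact measurable_const

theorem enorm_add_sq_le (x y : ℂ) : ‖x + y‖ₑ ^ 2 ≤ 2 * ‖x‖ₑ ^ 2 + 2 * ‖y‖ₑ ^ 2 := by
  have h : ‖x + y‖₊ ^ 2 ≤ 2 * ‖x‖₊ ^ 2 + 2 * ‖y‖₊ ^ 2 := by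
    rw [← NNReal.coe_le_coe]
    push_cast
    have := norm_add_le x y
    nlinarith [norm_nonneg (x + y), sq_nonneg (‖x‖ - ‖y‖)]
  simp only [enorm_eq_nnnorm]
  exact_mod_cast h

/-- The weighted Szegő space `AL₂(∂E_θ; ρ)` as a space of functions. -/
def szegoSubmodule (θ : ℝ) (ρ : ℂ → ℝ) : Submodule ℂ (ℂ → ℂ) where
  carrier := {f | IsSzego θ ρ f}
  zero_mem' :=
    { eq_zero := fun _ _ => rfl
      holomorphic := differentiableOn_const _
      bounded_means := ⟨0, by simp, by simp⟩
      nonTangential_limit := ae_of_all _ fun _ => ⟨0, tendsto_const_nhds⟩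
      memLp := by rw [boundaryValue_zero]; exact MemLp.zero }
  add_mem' := by
    intro f g hf hg
    refine ⟨fun z hz => ?_, hf.holomorphic.add hg.holomorphic, ?_, ?_, ?_⟩
    · simp [hf.eq_zero z hz, hg.eq_zero z hz]
    · obtain ⟨M, hM, hfM⟩ := hf.bounded_means
      obtain ⟨N, hN, hgN⟩ := hg.bounded_means
      refine ⟨2 * M + 2 * N, by
        exact ENNReal.add_lt_top.2 ⟨ENNReal.mul_lt_top (by simp) hM,
          ENNReal.mul_lt_top (by simp) hN⟩, fun s h1 h2 => ?_⟩
      calc ∫⁻ z, ‖(f + g) z‖ₑ ^ 2 ∂(arcLength s)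
          ≤ ∫⁻ z, (2 * ‖f z‖ₑ ^ 2 + 2 * ‖g z‖ₑ ^ 2) ∂(arcLength s) :=
            lintegral_mono fun z => enorm_add_sq_le _ _
        _ = 2 * ∫⁻ z, ‖f z‖ₑ ^ 2 ∂(arcLength s) + 2 * ∫⁻ z, ‖g z‖ₑ ^ 2 ∂(arcLength s) := by
            have mf := hf.measurable
            have mg := hg.measurable
            rw [lintegral_add_left (by fun_prop), lintegral_const_mul _ (by fun_prop),
              lintegral_const_mul _ (by fun_prop)]
        _ ≤ _ := by gcongr; exacts [hfM s h1 h2, hgN s h1 h2]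
    · filter_upwards [hf.nonTangential_limit, hg.nonTangential_limit] with ζ ⟨l, hl⟩ ⟨m, hm⟩
      exact ⟨l + m, hl.add hm⟩
    · exact (memLp_congr_ae
        (boundaryValue_add hf.nonTangential_limit hg.nonTangential_limit)).2 (hf.memLp.add hg.memLp)
  smul_mem' := by
    intro c f hf
    refine ⟨fun z hz => ?_, hf.holomorphic.const_smul c, ?_, ?_, ?_⟩
    · simp [hf.eq_zero z hz]
    · obtain ⟨M, hM, hfM⟩ := hf.bounded_means
      refine ⟨‖c‖ₑ ^ 2 * M, ENNReal.mul_lt_top (by simp) hM, fun s h1 h2 => ?_⟩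
      have mf := hf.measurable
      simp only [Pi.smul_apply, enorm_smul, mul_pow]
      rw [lintegral_const_mul _ (by fun_prop)]
      gcongr
      exact hfM s h1 h2
    · filter_upwards [hf.nonTangential_limit] with ζ ⟨l, hl⟩
      exact ⟨c • l, hl.const_smul c⟩
    · exact (memLp_congr_ae (boundaryValue_smul c hf.nonTangential_limit)).2 (hf.memLp.const_smul c)

/-- The weighted Szegő space `AL₂(∂E_θ; ρ)`. It is a type of its own, so that it carries the
topology of its norm and not that of pointwise convergence. -/
def SzegoSpace (θ : ℝ) (ρ : ℂ → ℝ) : Type := ↥(szegoSubmodule θ ρ)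

namespace SzegoSpace

variable {θ : ℝ} {ρ : ℂ → ℝ}

instance : AddCommGroup (SzegoSpace θ ρ) := inferInstanceAs (AddCommGroup ↥(szegoSubmodule θ ρ))

instance : Module ℂ (SzegoSpace θ ρ) := inferInstanceAs (Module ℂ ↥(szegoSubmodule θ ρ))

/-- The underlying function (extended by zero outside of the ellipse). -/
def toFun (f : SzegoSpace θ ρ) : ℂ → ℂ := Subtype.val f

/-- The boundary function of an element of the Szegő space. -/
def trace (f : SzegoSpace θ ρ) : ℂ → ℂ := boundaryValue θ f.toFun

theorem isSzego (f : SzegoSpace θ ρ) : IsSzego θ ρ f.toFun := Subtype.property f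

theorem trace_add (f g : SzegoSpace θ ρ) :
    (f + g).trace =ᵐ[weightedArcLength θ ρ] f.trace + g.trace :=
  boundaryValue_add f.isSzego.nonTangential_limit g.isSzego.nonTangential_limit

theorem trace_smul (c : ℂ) (f : SzegoSpace θ ρ) :
    (c • f).trace =ᵐ[weightedArcLength θ ρ] c • f.trace :=
  boundaryValue_smul c f.isSzego.nonTangential_limit

theorem integrable_inner (f g : SzegoSpace θ ρ) :
    Integrable (fun z => starRingEnd ℂ (f.trace z) * g.trace z) (weightedArcLength θ ρ) :=
  MemLp.integrable_mul (p := 2) (q := 2) f.isSzego.memLp.star g.isSzego.memLp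

/-- The (semi-)inner product `⟪f, g⟫ = ∫_{∂E_θ} conj (f z) g z ρ z |dz|` of boundary functions
(antilinear in the first argument). -/
@[reducible] def innerCore (θ : ℝ) (ρ : ℂ → ℝ) : PreInnerProductSpace.Core ℂ (SzegoSpace θ ρ) where
  inner f g := ∫ z, starRingEnd ℂ (f.trace z) * g.trace z ∂(weightedArcLength θ ρ)
  conj_inner_symm f g := by
    rw [← integral_conj]
    congr 1
    ext z
    simp [mul_comm]
  re_inner_nonneg f := by
    have h : ∀ z, starRingEnd ℂ (f.trace z) * f.trace z = ((‖f.trace z‖ ^ 2 : ℝ) : ℂ) := fun z => by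
      rw [Complex.conj_mul']
      push_cast
      rfl
    simp only [h]
    rw [integral_complex_ofReal]
    exact integral_nonneg fun z => by positivity
  add_left f g h := by
    rw [← integral_add (integrable_inner f h) (integrable_inner g h)]
    refine integral_congr_ae ?_
    filter_upwards [trace_add f g] with z hz
    simp [hz, add_mul]
  smul_left f g c := by
    rw [← integral_const_mul]
    refine integral_congr_ae ?_
    filter_upwards [trace_smul c f] with z hz
    simp [hz, mul_assoc]

/-- The (semi-)norm `‖f‖ = (∫_{∂E_θ} |f z|² ρ z |dz|)^{1/2}`. -/
instance : SeminormedAddCommGroup (SzegoSpace θ ρ) :=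
  @InnerProductSpace.Core.toSeminormedAddCommGroup ℂ _ _ _ _ (innerCore θ ρ)

instance : InnerProductSpace ℂ (SzegoSpace θ ρ) := InnerProductSpace.ofCore (innerCore θ ρ)

end SzegoSpace

/-- The weight `|z² - 1|^{-1/2}`. -/
def chebyshevWeight (z : ℂ) : ℝ := ‖z ^ 2 - 1‖ ^ (-(1 / 2) : ℝ)

/-- The Chebyshev polynomials of the first kind, orthonormal on `(-1, 1)` with respect to
`(1 - x²)^{-1/2}`: `(1/π)^{1/2} T₀` and `(2/π)^{1/2} T_k` for `k ≥ 1`. -/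
def orthonormalChebyshev (k : ℕ) : Polynomial ℂ :=
  Polynomial.C ((if k = 0 then √(1 / Real.pi) else √(2 / Real.pi) : ℝ) : ℂ) *
    Polynomial.Chebyshev.T ℂ k

end SzegoEllipse

end

/-!
The Joukowski map `J w = (w + 1 / w) / 2` carries the circles `|w| = r`, `1 < r < √θ`, to the
boundaries of the confocal ellipses `E_{r²}`, and on `∂E_θ` the weighted arc length
`|z² - 1|^{-1/2} |dz|` becomes the Lebesgue measure `dt` of `w = √θ e^{it}`
(`weightedArcLength_eq_map`). The normalized Chebyshev polynomials become
`m_k (w ^ k + w ^ (-k))`, so they are orthogonal on every confocal ellipse, and orthonormal on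
`∂E_θ`.

The theorem follows from the statement that `a ↦ ∑ a_k e_k`, with `e_k` the normalized Chebyshev
polynomials, is an isometry of the space of square summable sequences onto the Szegő space
(`chebyshevSynthesis`, `norm_chebyshevSynthesis`, `surjective_chebyshevSynthesis`): the Szegő space
inherits completeness and the definiteness of the norm, and the images of the unit sequences form an
orthonormal basis.

* Synthesis. For square summable `a` the series splits, in the variable `w`, into a function of the
  Hardy space `H²` of the disc `|w| < √θ` and a function holomorphic across `|w| = √θ`. So its
  nontangential limits exist almost everywhere by Fatou's theorem (`ae_exists_tendsto_powerSum`).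
  Orthogonality on the smaller ellipses and Fatou's lemma bound the norm of the boundary function by
  that of `a`; on finitely supported sequences this is an equality, hence it is one everywhere.

* Fatou's theorem. The primitive `H` of an `H²` power series is continuous on the closed disc and of
  bounded variation on the circle, hence differentiable along the circle at almost every point `ζ₀`.
  After subtraction of a linear function, `H = o(ζ - ζ₀)` on the circle. Cauchy's formula for `H'`,
  with the kernel reflected in the circle subtracted, has a kernel bounded by a multiple of
  `1 / |ζ - w|` times the Poisson kernel, which forces `H' → 0` nontangentially at `ζ₀`
  (`tendsto_deriv_stolz`).

* Analysis. For `f` in the Szegő space, `f ∘ J` is holomorphic in the annulus `1/√θ < |w| < √θ` and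
  invariant under `w ↦ 1 / w`. By Cauchy's theorem the Fourier coefficients on `|w| = r` are
  `γ_k r ^ k` with `γ_k = γ_{-k}`, and the Hardy-Smirnov condition with Parseval's identity gives
  `∑ |γ_k|² θ ^ k < ∞`. The Fourier series converges to `f ∘ J` at every point, so `f` is a
  Chebyshev series with square summable coefficients (`exists_eq_chebyshevSeries`).
-/

namespace SzegoEllipse

/-! ### Boundary behaviour of derivatives of holomorphic functions in the disc -/

/-- Cauchy's formula for the derivative, with a multiple of the square of the Cauchy kernel at the
reflected point `1 / conj w` subtracted. The reflected kernel is holomorphic in the disc and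
contributes nothing to the integral, but its subtraction makes the kernel decay one order faster. -/
theorem deriv_eq_circleIntegral_reflected {D : ℂ → ℂ} (hD : DiffContOnCl ℂ D (Metric.ball 0 1))
    {w : ℂ} (hw : ‖w‖ < 1) :
    deriv D w = (2 * Real.pi * Complex.I)⁻¹ * ∮ ζ in C(0, 1),
      (((ζ - w) ^ 2)⁻¹ - (starRingEnd ℂ w) ^ 2 * ((1 - starRingEnd ℂ w * ζ) ^ 2)⁻¹) * D ζ := by
  have hwb : w ∈ Metric.ball (0 : ℂ) 1 := by simpa using hw
  have hcont : ContinuousOn D (Metric.closedBall 0 1) := hD.continuousOn_ball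
  have hcs : ContinuousOn D (Metric.sphere 0 1) := hcont.mono Metric.sphere_subset_closedBall
  have hne : ∀ ζ ∈ Metric.closedBall (0 : ℂ) 1, 1 - starRingEnd ℂ w * ζ ≠ 0 := by
    intro ζ hζ h
    have h1 : starRingEnd ℂ w * ζ = 1 := (sub_eq_zero.1 h).symm
    have h2 : ‖w‖ * ‖ζ‖ = 1 := by simpa using congrArg norm h1
    have h3 : ‖ζ‖ ≤ 1 := by simpa using hζ
    nlinarith [norm_nonneg w, norm_nonneg ζ]
  have hns : ∀ ζ ∈ Metric.sphere (0 : ℂ) 1, (ζ - w) ^ 2 ≠ 0 := by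
    intro ζ hζ h
    have h1 : ζ = w := sub_eq_zero.1 (pow_eq_zero_iff two_ne_zero |>.1 h)
    have h2 : ‖ζ‖ = 1 := by simpa using hζ
    rw [h1] at h2
    linarith
  have c1 : ContinuousOn (fun ζ : ℂ => ((ζ - w) ^ 2)⁻¹) (Metric.sphere 0 1) :=
    ContinuousOn.inv₀ (by fun_prop) hns
  have hrefl : DiffContOnCl ℂ
      (fun ζ => ((starRingEnd ℂ w) ^ 2 * ((1 - starRingEnd ℂ w * ζ) ^ 2)⁻¹) * D ζ)
      (Metric.ball 0 1) := by
    refine ⟨DifferentiableOn.mul (DifferentiableOn.const_mul (DifferentiableOn.inv (by fun_prop)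
      fun ζ hζ => pow_ne_zero 2 (hne ζ (Metric.ball_subset_closedBall hζ))) _) hD.1, ?_⟩
    rw [closure_ball 0 one_ne_zero]
    exact ContinuousOn.mul (ContinuousOn.mul continuousOn_const (ContinuousOn.inv₀ (by fun_prop)
      fun ζ hζ => pow_ne_zero 2 (hne ζ hζ))) hcont
  have hzero := hrefl.circleIntegral_eq_zero zero_le_one
  have hdsl : DiffContOnCl ℂ (dslope D w) (Metric.ball 0 1) := by
    refine ⟨(Complex.differentiableOn_dslope (Metric.isOpen_ball.mem_nhds hwb)).2 hD.1, ?_⟩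
    rw [closure_ball 0 one_ne_zero]
    exact (continuousOn_dslope (Metric.closedBall_mem_nhds_of_mem hwb)).2
      ⟨hcont, hD.differentiableAt Metric.isOpen_ball hwb⟩
  have h0 := hdsl.two_pi_i_inv_smul_circleIntegral_sub_inv_smul hwb
  rw [dslope_same] at h0
  have i1 : CircleIntegrable (fun ζ : ℂ => ((ζ - w) ^ 2)⁻¹ * D ζ) 0 1 :=
    ContinuousOn.circleIntegrable zero_le_one (c1.mul hcs)
  have i2 : CircleIntegrable (fun ζ : ℂ => ((ζ - w) ^ 2)⁻¹ * D w) 0 1 :=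
    ContinuousOn.circleIntegrable zero_le_one (c1.mul continuousOn_const)
  have i3 : CircleIntegrable
      (fun ζ => ((starRingEnd ℂ w) ^ 2 * ((1 - starRingEnd ℂ w * ζ) ^ 2)⁻¹) * D ζ) 0 1 :=
    ContinuousOn.circleIntegrable zero_le_one
      (hrefl.continuousOn_ball.mono Metric.sphere_subset_closedBall)
  have h4 : (∮ ζ : ℂ in C(0, 1), ((ζ - w) ^ 2)⁻¹ * D w) = 0 := by
    have : (∮ ζ : ℂ in C(0, 1), ((ζ - w) ^ 2)⁻¹) = 0 := by
      simpa using! circleIntegral.integral_sub_zpow_of_ne (by decide : (-2 : ℤ) ≠ -1) 0 w 1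
    have h := circleIntegral.integral_smul_const (fun ζ : ℂ => ((ζ - w) ^ 2)⁻¹) (D w) 0 1
    simp only [smul_eq_mul] at h
    rw [h, this, zero_mul]
  rw [← h0, smul_eq_mul]
  congr 1
  simp only [sub_mul]
  have h5 : (∮ ζ in C(0, 1), ((ζ - w) ^ 2)⁻¹ * D ζ)
      = (∮ ζ in C(0, 1), ((ζ - w) ^ 2)⁻¹ * D ζ) - ∮ ζ in C(0, 1), ((ζ - w) ^ 2)⁻¹ * D w := by
    rw [h4, sub_zero]
  rw [circleIntegral.integral_sub i1 i3, hzero, sub_zero, h5, ← circleIntegral.integral_sub i1 i2]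
  refine circleIntegral.integral_congr zero_le_one fun ζ hζ => ?_
  have hζw : ζ ≠ w := fun h => hns ζ hζ (by simp [h])
  simp only [dslope_of_ne _ hζw, slope, vsub_eq_sub, smul_eq_mul, sq, mul_inv]
  ring

theorem norm_one_sub_conj_mul {w ζ : ℂ} (hζ : ‖ζ‖ = 1) : ‖1 - starRingEnd ℂ w * ζ‖ = ‖ζ - w‖ := by
  have h : 1 - starRingEnd ℂ w * ζ = starRingEnd ℂ (ζ - w) * ζ := by
    rw [map_sub, sub_mul, mul_comm (starRingEnd ℂ ζ), Complex.mul_conj']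
    simp [hζ]
  rw [h, norm_mul, hζ, mul_one, Complex.norm_conj]

/-- The difference of the kernel and its reflection is at most `4 / ‖ζ - w‖` times the Poisson
kernel. -/
theorem norm_reflected_kernel_le {w ζ : ℂ} (hw : ‖w‖ < 1) (hζ : ‖ζ‖ = 1) :
    ‖((ζ - w) ^ 2)⁻¹ - (starRingEnd ℂ w) ^ 2 * ((1 - starRingEnd ℂ w * ζ) ^ 2)⁻¹‖
      ≤ 4 * (1 - ‖w‖ ^ 2) / ‖ζ - w‖ ^ 3 := by
  have hpos : 1 - ‖w‖ ≤ ‖ζ - w‖ := by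
    have := norm_sub_norm_le ζ w
    rwa [hζ] at this
  have hd : 0 < ‖ζ - w‖ := by linarith
  have h1 : ζ - w ≠ 0 := norm_pos_iff.1 hd
  have h2 : 1 - starRingEnd ℂ w * ζ ≠ 0 := norm_pos_iff.1 (by rwa [norm_one_sub_conj_mul hζ])
  have hw2 : starRingEnd ℂ w * w = ((‖w‖ ^ 2 : ℝ) : ℂ) := by
    rw [Complex.conj_mul']; push_cast; rfl
  have key : ((ζ - w) ^ 2)⁻¹ - (starRingEnd ℂ w) ^ 2 * ((1 - starRingEnd ℂ w * ζ) ^ 2)⁻¹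
      = ((1 - ‖w‖ ^ 2 : ℝ) : ℂ) * (2 * (1 - starRingEnd ℂ w * ζ) - ((1 - ‖w‖ ^ 2 : ℝ) : ℂ))
        / ((ζ - w) ^ 2 * (1 - starRingEnd ℂ w * ζ) ^ 2) := by
    have e : ((1 - ‖w‖ ^ 2 : ℝ) : ℂ) = 1 - starRingEnd ℂ w * w := by rw [hw2]; push_cast; ring
    rw [e, eq_div_iff (by positivity), sub_mul, mul_assoc ((starRingEnd ℂ) w ^ 2),
      inv_mul_cancel_left₀ (pow_ne_zero 2 h1), mul_comm ((ζ - w) ^ 2),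
      inv_mul_cancel_left₀ (pow_ne_zero 2 h2)]
    ring
  have hn : 0 ≤ 1 - ‖w‖ ^ 2 := by nlinarith [norm_nonneg w]
  have hb : ‖2 * (1 - starRingEnd ℂ w * ζ) - ((1 - ‖w‖ ^ 2 : ℝ) : ℂ)‖ ≤ 4 * ‖ζ - w‖ := by
    refine (norm_sub_le _ _).trans ?_
    rw [norm_mul, norm_one_sub_conj_mul hζ, Complex.norm_real, Real.norm_of_nonneg hn]
    norm_num
    nlinarith [norm_nonneg w]
  rw [key, norm_div, norm_mul, norm_mul, norm_pow, norm_pow, norm_one_sub_conj_mul hζ,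
    Complex.norm_real, Real.norm_of_nonneg hn, div_le_div_iff₀ (by positivity) (by positivity)]
  calc (1 - ‖w‖ ^ 2) * ‖2 * (1 - starRingEnd ℂ w * ζ) - ((1 - ‖w‖ ^ 2 : ℝ) : ℂ)‖ * ‖ζ - w‖ ^ 3
      ≤ (1 - ‖w‖ ^ 2) * (4 * ‖ζ - w‖) * ‖ζ - w‖ ^ 3 := by gcongr
    _ = _ := by ring

theorem integral_poissonKernel {w : ℂ} (hw : ‖w‖ < 1) :
    ∫ t in (0)..2 * Real.pi, poissonKernel 0 w (circleMap 0 1 t) = 2 * Real.pi := by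
  have h := DiffContOnCl.circleAverage_poissonKernel_smul (c := 0) (R := 1) (w := w)
    (f := fun _ => (1 : ℂ)) diffContOnCl_const (by simpa using hw)
  rw [Real.circleAverage_def] at h
  simp only [Pi.smul_apply', Complex.real_smul, mul_one] at h
  rw [intervalIntegral.integral_ofReal] at h
  have h' : (2 * Real.pi)⁻¹ * ∫ t in (0)..2 * Real.pi, poissonKernel 0 w (circleMap 0 1 t) = 1 := by
    exact_mod_cast h
  have := Real.pi_pos
  field_simp at h'
  linarith

theorem continuous_poissonKernel_circleMap {w : ℂ} (hw : ‖w‖ < 1) :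
    Continuous fun t => poissonKernel 0 w (circleMap 0 1 t) := by
  simp only [poissonKernel_def, sub_zero]
  refine Continuous.div (by fun_prop) (by fun_prop) fun t h => ?_
  have h1 : circleMap 0 1 t = w := by
    simpa [sub_eq_zero] using h
  have : ‖circleMap 0 1 t‖ = 1 := by simp
  rw [h1] at this
  linarith

/-- A pointwise bound by the Poisson kernel and a constant integrates to a bound of the derivative,
since the Poisson kernel has mean value one. -/
theorem norm_deriv_le_of_poissonKernel {D : ℂ → ℂ} (hD : DiffContOnCl ℂ D (Metric.ball 0 1))
    {w : ℂ} (hw : ‖w‖ < 1) {α β : ℝ}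
    (h : ∀ ζ, ‖ζ‖ = 1 → 4 * (1 - ‖w‖ ^ 2) / ‖ζ - w‖ ^ 3 * ‖D ζ‖ ≤ α * poissonKernel 0 w ζ + β) :
    ‖deriv D w‖ ≤ α + β := by
  have hc := continuous_poissonKernel_circleMap hw
  rw [deriv_eq_circleIntegral_reflected hD hw, norm_mul, circleIntegral]
  have hb : ‖∫ t in (0)..2 * Real.pi, deriv (circleMap 0 1) t •
      ((((circleMap 0 1 t - w) ^ 2)⁻¹ - (starRingEnd ℂ w) ^ 2 *
        ((1 - starRingEnd ℂ w * circleMap 0 1 t) ^ 2)⁻¹) * D (circleMap 0 1 t))‖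
      ≤ ∫ t in (0)..2 * Real.pi, (α * poissonKernel 0 w (circleMap 0 1 t) + β) := by
    refine intervalIntegral.norm_integral_le_of_norm_le Real.two_pi_pos.le
      (ae_of_all _ fun t _ => ?_) (Continuous.intervalIntegrable (by fun_prop) _ _)
    have hζ : ‖circleMap 0 1 t‖ = 1 := by simp
    rw [norm_smul, norm_mul]
    simp only [deriv_circleMap, norm_mul, Complex.norm_I, hζ, one_mul]
    exact (mul_le_mul_of_nonneg_right (norm_reflected_kernel_le hw hζ) (norm_nonneg _)).trans
      (h _ hζ)
  rw [intervalIntegral.integral_add (Continuous.intervalIntegrable (by fun_prop) _ _)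
    (by simp), intervalIntegral.integral_const_mul,
    integral_poissonKernel hw, intervalIntegral.integral_const, sub_zero, smul_eq_mul] at hb
  have hp : ‖(2 * Real.pi * Complex.I : ℂ)⁻¹‖ = (2 * Real.pi)⁻¹ := by
    simp [abs_of_pos Real.pi_pos]
  rw [hp, inv_mul_le_iff₀ Real.two_pi_pos]
  linarith

/-- If the boundary values of a holomorphic function vanish to first order at a point of the unit
circle, the derivative tends to zero in every Stolz region at this point. -/
theorem tendsto_deriv_stolz {D : ℂ → ℂ} (hD : DiffContOnCl ℂ D (Metric.ball 0 1)) {ζ₀ : ℂ}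
    (hζ₀ : ‖ζ₀‖ = 1) (ho : D =o[𝓝[Metric.sphere 0 1] ζ₀] fun ζ => ζ - ζ₀) (K : ℝ) :
    Tendsto (deriv D) (𝓝[{w | ‖w‖ < 1 ∧ ‖w - ζ₀‖ ≤ K * (1 - ‖w‖)}] ζ₀) (𝓝 0) := by
  have hcs : ContinuousOn D (Metric.sphere 0 1) :=
    hD.continuousOn_ball.mono Metric.sphere_subset_closedBall
  obtain ⟨M, hM⟩ := (isCompact_sphere (0 : ℂ) 1).exists_bound_of_continuousOn hcs
  have hM0 : 0 ≤ M := (norm_nonneg _).trans (hM ζ₀ (by simpa using hζ₀))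
  rw [Metric.tendsto_nhds]
  intro η hη
  set K' : ℝ := 1 + |K| with hK'
  have hK0 : 0 < K' := by positivity
  set ε : ℝ := η / (16 * K') with hε
  have hε0 : 0 < ε := by positivity
  have ho' := ho.def hε0
  rw [eventually_nhdsWithin_iff, Metric.eventually_nhds_iff] at ho'
  obtain ⟨δ, hδ, hδD⟩ := ho'
  -- away from `ζ₀`, `‖D‖` is dominated by a multiple of the cube of the distance
  have hbound : ∀ ζ, ‖ζ‖ = 1 → ‖D ζ‖ ≤ ε * ‖ζ - ζ₀‖ + M / δ ^ 3 * ‖ζ - ζ₀‖ ^ 3 := by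
    intro ζ hζ
    by_cases hd : dist ζ ζ₀ < δ
    · have := hδD hd (by simpa using hζ)
      have h2 : 0 ≤ M / δ ^ 3 * ‖ζ - ζ₀‖ ^ 3 := by positivity
      linarith
    · have h1 : δ ≤ ‖ζ - ζ₀‖ := by rw [← dist_eq_norm]; exact not_lt.1 hd
      have h2 := hM ζ (by simpa using hζ)
      have h3 : M ≤ M / δ ^ 3 * ‖ζ - ζ₀‖ ^ 3 := by
        rw [div_mul_eq_mul_div, le_div_iff₀ (by positivity)]
        gcongr
      have h4 : 0 ≤ ε * ‖ζ - ζ₀‖ := by positivity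
      linarith
  have hsmall : ∀ᶠ w in 𝓝 ζ₀, 8 * (M / δ ^ 3) * K' ^ 3 * (1 - ‖w‖) < η / 2 := by
    have hc : Continuous fun w : ℂ => 8 * (M / δ ^ 3) * K' ^ 3 * (1 - ‖w‖) := by fun_prop
    refine (hc.tendsto ζ₀).eventually_lt_const ?_
    simp only [hζ₀, sub_self, mul_zero]
    positivity
  filter_upwards [nhdsWithin_le_nhds hsmall, self_mem_nhdsWithin] with w hw1 ⟨hw, hwK⟩
  rw [dist_zero_right]
  have hn : 0 ≤ 1 - ‖w‖ ^ 2 := by nlinarith [norm_nonneg w]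
  have := norm_deriv_le_of_poissonKernel hD hw (α := 4 * ε * K')
    (β := 8 * (M / δ ^ 3) * K' ^ 3 * (1 - ‖w‖)) fun ζ hζ => by
      have hpos : 1 - ‖w‖ ≤ ‖ζ - w‖ := by
        have := norm_sub_norm_le ζ w
        rwa [hζ] at this
      have hd : 0 < ‖ζ - w‖ := by linarith
      have hKd : ‖ζ - ζ₀‖ ≤ K' * ‖ζ - w‖ := by
        have h1 : ‖ζ - ζ₀‖ ≤ ‖ζ - w‖ + ‖w - ζ₀‖ := norm_sub_le_norm_sub_add_norm_sub ..
        have h2 : K * (1 - ‖w‖) ≤ |K| * ‖ζ - w‖ :=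
          mul_le_mul (le_abs_self K) hpos (by linarith) (abs_nonneg K)
        rw [hK']
        linarith
      have hDζ : ‖D ζ‖ ≤ ε * (K' * ‖ζ - w‖) + M / δ ^ 3 * (K' * ‖ζ - w‖) ^ 3 :=
        (hbound ζ hζ).trans (by gcongr)
      calc 4 * (1 - ‖w‖ ^ 2) / ‖ζ - w‖ ^ 3 * ‖D ζ‖
          ≤ 4 * (1 - ‖w‖ ^ 2) / ‖ζ - w‖ ^ 3 *
            (ε * (K' * ‖ζ - w‖) + M / δ ^ 3 * (K' * ‖ζ - w‖) ^ 3) := by gcongr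
        _ = 4 * ε * K' * poissonKernel 0 w ζ + 4 * (M / δ ^ 3) * K' ^ 3 * (1 - ‖w‖ ^ 2) := by
            simp only [poissonKernel_def, sub_zero, hζ]
            field_simp
        _ ≤ _ := by
            have h5 : 1 - ‖w‖ ^ 2 ≤ 2 * (1 - ‖w‖) := by nlinarith
            have h6 : 0 ≤ 4 * (M / δ ^ 3) * K' ^ 3 := by positivity
            nlinarith
  have h7 : 4 * ε * K' = η / 4 := by rw [hε]; field_simp; norm_num
  linarith

/-! ### Orthogonal families on the circle -/

theorem integral_exp_int_mul_I {n : ℤ} (hn : n ≠ 0) :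
    ∫ t in (0)..2 * Real.pi, Complex.exp (n * t * Complex.I) = 0 := by
  have hc : (n * Complex.I : ℂ) ≠ 0 := by simp [hn]
  have h := integral_exp_mul_complex (a := 0) (b := 2 * Real.pi) hc
  have e : ∀ t : ℝ, Complex.exp (n * t * Complex.I) = Complex.exp (n * Complex.I * t) := fun t => by
    ring_nf
  simp only [e]
  rw [h]
  have : (n * Complex.I * ((2 * Real.pi : ℝ) : ℂ)) = n * (2 * Real.pi * Complex.I) := by
    push_cast; ring
  rw [this, Complex.exp_int_mul_two_pi_mul_I]
  simp

/-- Pythagoras for finite sums of functions orthogonal on `[0, 2π]`. -/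
theorem integral_norm_sq_sum_eq {ι : Type*} {ψ : ι → ℝ → ℂ} (hψ : ∀ k, Continuous (ψ k))
    (ho : ∀ j k, j ≠ k → ∫ t in (0)..2 * Real.pi, starRingEnd ℂ (ψ j t) * ψ k t = 0)
    (s : Finset ι) :
    ∫ t in (0)..2 * Real.pi, ‖∑ k ∈ s, ψ k t‖ ^ 2
      = ∑ k ∈ s, ∫ t in (0)..2 * Real.pi, ‖ψ k t‖ ^ 2 := by
  have hsq : ∀ z : ℂ, ((‖z‖ ^ 2 : ℝ) : ℂ) = starRingEnd ℂ z * z := fun z => by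
    rw [Complex.conj_mul']; push_cast; rfl
  have hc : ∀ k, Continuous fun t => starRingEnd ℂ (ψ k t) := fun k =>
    Complex.continuous_conj.comp (hψ k)
  apply Complex.ofReal_injective
  rw [← intervalIntegral.integral_ofReal]
  push_cast
  simp only [← intervalIntegral.integral_ofReal, hsq, ← Complex.ofReal_pow]
  simp only [map_sum, Finset.sum_mul_sum]
  rw [intervalIntegral.integral_finsetSum (f := fun i t => ∑ j ∈ s, starRingEnd ℂ (ψ i t) * ψ j t)
    fun i _ => Continuous.intervalIntegrable
      (continuous_finsetSum _ fun j _ => (hc i).mul (hψ j)) _ _]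
  refine Finset.sum_congr rfl fun i hi => ?_
  rw [intervalIntegral.integral_finsetSum (f := fun j t => starRingEnd ℂ (ψ i t) * ψ j t)
    fun j _ => Continuous.intervalIntegrable ((hc i).mul (hψ j)) _ _]
  rw [Finset.sum_eq_single_of_mem i hi fun j _ hj => ho i j hj.symm]

/-- The mean square of a pointwise convergent series of functions orthogonal on `[0, 2π]` is at
most the sum of the mean squares. -/
theorem lintegral_enorm_sq_le_of_hasSum {ψ : ℕ → ℝ → ℂ} (hψ : ∀ k, Continuous (ψ k))
    (ho : ∀ j k, j ≠ k → ∫ t in (0)..2 * Real.pi, starRingEnd ℂ (ψ j t) * ψ k t = 0)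
    {F : ℝ → ℂ} (hF : ∀ t, HasSum (fun k => ψ k t) (F t)) {C : ℝ}
    (hC : ∀ s : Finset ℕ, ∑ k ∈ s, ∫ t in (0)..2 * Real.pi, ‖ψ k t‖ ^ 2 ≤ C) :
    ∫⁻ t in Ioc 0 (2 * Real.pi), ‖F t‖ₑ ^ 2 ≤ ENNReal.ofReal C := by
  set G : ℕ → ℝ → ENNReal := fun n t => ‖∑ k ∈ Finset.range n, ψ k t‖ₑ ^ 2 with hG
  have hcont : ∀ n, Continuous fun t => ∑ k ∈ Finset.range n, ψ k t := fun n =>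
    continuous_finsetSum _ fun k _ => hψ k
  have hlim : ∀ t, ‖F t‖ₑ ^ 2 = liminf (fun n => G n t) atTop := fun t =>
    ((ENNReal.continuous_pow 2).continuousAt.tendsto.comp
      (hF t).tendsto_sum_nat.enorm).liminf_eq.symm
  simp only [hlim]
  refine (lintegral_liminf_le fun n => ?_).trans ?_
  · have := (hcont n).measurable
    fun_prop
  refine liminf_le_of_le (by isBoundedDefault) fun b hb => ?_
  obtain ⟨n, hn⟩ := hb.exists
  refine hn.trans ?_
  have e : ∀ t, G n t = ENNReal.ofReal (‖∑ k ∈ Finset.range n, ψ k t‖ ^ 2) := fun t => by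
    rw [hG, ENNReal.ofReal_pow (norm_nonneg _), ofReal_norm]
  simp only [e]
  rw [← ofReal_integral_eq_lintegral_ofReal]
  · rw [← intervalIntegral.integral_of_le Real.two_pi_pos.le, integral_norm_sq_sum_eq hψ ho]
    exact ENNReal.ofReal_le_ofReal (hC _)
  · exact (((hcont n).norm.pow 2).integrableOn_Ioc)
  · exact ae_of_all _ fun t => by positivity

/-! ### Nontangential limits of square summable power series -/

/-- The power series with coefficients `u`. -/
noncomputable def powerSum (u : ℕ → ℂ) (w : ℂ) : ℂ := ∑' k, u k * w ^ k

/-- The primitive of `powerSum u` that vanishes at the origin. -/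
noncomputable def powerSumPrimitive (u : ℕ → ℂ) (w : ℂ) : ℂ := ∑' k : ℕ, u k / (k + 1) * w ^ (k + 1)

theorem summable_norm_div_succ {u : ℕ → ℂ} (hu : Summable fun k => ‖u k‖ ^ 2) :
    Summable fun k : ℕ => ‖u k‖ / (k + 1) := by
  have h2 : Summable fun k : ℕ => (1 / ((k : ℝ) + 1)) ^ 2 := by
    have := (summable_nat_add_iff 1).2 (Real.summable_one_div_nat_pow.2 one_lt_two)
    refine this.congr fun k => ?_
    push_cast
    rw [div_pow, one_pow]
  refine Summable.of_nonneg_of_le (fun k => by positivity) (fun k => ?_) (hu.add h2)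
  have h := sq_nonneg (‖u k‖ - 1 / ((k : ℝ) + 1))
  have h3 : 0 ≤ ‖u k‖ ^ 2 + (1 / ((k : ℝ) + 1)) ^ 2 := by positivity
  have e : ‖u k‖ / ((k : ℝ) + 1) = ‖u k‖ * (1 / ((k : ℝ) + 1)) := by ring
  rw [e]
  nlinarith

theorem norm_powerSumPrimitive_term_le (u : ℕ → ℂ) (k : ℕ) {w : ℂ} (hw : ‖w‖ ≤ 1) :
    ‖u k / (k + 1) * w ^ (k + 1)‖ ≤ ‖u k‖ / (k + 1) := by
  have h1 : ‖((k : ℂ) + 1)‖ = k + 1 := by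
    have : ((k : ℂ) + 1) = ((k + 1 : ℕ) : ℂ) := by push_cast; rfl
    rw [this, Complex.norm_natCast]; push_cast; rfl
  rw [norm_mul, norm_div, norm_pow, h1]
  exact mul_le_of_le_one_right (by positivity) (pow_le_one₀ (norm_nonneg _) hw)

theorem diffContOnCl_powerSumPrimitive {u : ℕ → ℂ} (hu : Summable fun k => ‖u k‖ ^ 2) :
    DiffContOnCl ℂ (powerSumPrimitive u) (Metric.ball 0 1) := by
  refine ⟨Complex.differentiableOn_tsum_of_summable_norm (summable_norm_div_succ hu)
    (fun k => by fun_prop) Metric.isOpen_ball fun k w hw =>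
      norm_powerSumPrimitive_term_le u k (by simpa using (Metric.mem_ball.1 hw).le), ?_⟩
  rw [closure_ball 0 one_ne_zero]
  exact continuousOn_tsum (fun k => by fun_prop) (summable_norm_div_succ hu) fun k w hw =>
    norm_powerSumPrimitive_term_le u k (by simpa using hw)

theorem deriv_powerSumPrimitive {u : ℕ → ℂ} (hu : Summable fun k => ‖u k‖ ^ 2)
    {w : ℂ} (hw : ‖w‖ < 1) :
    deriv (powerSumPrimitive u) w = powerSum u w := by
  have h := Complex.hasSum_deriv_of_summable_norm (summable_norm_div_succ hu)
    (F := fun (k : ℕ) (w : ℂ) => u k / (k + 1) * w ^ (k + 1))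
    (fun k => by fun_prop) Metric.isOpen_ball (fun k w (hw : w ∈ Metric.ball (0 : ℂ) 1) =>
      norm_powerSumPrimitive_term_le u k (by simpa using (Metric.mem_ball.1 hw).le))
    (z := w) (by simpa using hw)
  refine h.tsum_eq.symm.trans (tsum_congr fun k => ?_)
  have hk : ((k : ℂ) + 1) ≠ 0 := by exact_mod_cast Nat.succ_ne_zero k
  simp
  field_simp

theorem eVariationOn_le_integral_norm_deriv {h g : ℝ → ℂ} (hd : ∀ t, HasDerivAt h (g t) t)
    (hg : Continuous g) {a b : ℝ} :
    eVariationOn h (Icc a b) ≤ ENNReal.ofReal (∫ t in a..b, ‖g t‖) := by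
  have hi : ∀ x y, IntervalIntegrable (fun t => ‖g t‖) volume x y := fun x y =>
    hg.norm.intervalIntegrable _ _
  refine iSup_le fun ⟨n, u, hu, hmem⟩ => ?_
  calc ∑ i ∈ Finset.range n, edist (h (u (i + 1))) (h (u i))
      ≤ ∑ i ∈ Finset.range n, ENNReal.ofReal (∫ t in u i..u (i + 1), ‖g t‖) := by
        refine Finset.sum_le_sum fun i _ => ?_
        rw [edist_dist, dist_eq_norm]
        refine ENNReal.ofReal_le_ofReal ?_
        rw [← intervalIntegral.integral_eq_sub_of_hasDerivAt (fun t _ => hd t)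
          (hg.intervalIntegrable _ _)]
        exact intervalIntegral.norm_integral_le_integral_norm (hu i.le_succ)
    _ = ENNReal.ofReal (∫ t in u 0..u n, ‖g t‖) := by
        rw [← ENNReal.ofReal_sum_of_nonneg fun i _ =>
          intervalIntegral.integral_nonneg (hu i.le_succ) fun t _ => norm_nonneg _,
          intervalIntegral.sum_integral_adjacent_intervals fun i _ => hi _ _]
    _ ≤ _ := ENNReal.ofReal_le_ofReal (intervalIntegral.integral_mono_interval (hmem 0).1
        (hu (Nat.zero_le n)) (hmem n).2 (ae_of_all _ fun t => norm_nonneg _) (hi _ _))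

theorem integral_conj_exp_mul_exp {c d : ℂ} {m n : ℤ} (h : m ≠ n) :
    ∫ t in (0)..2 * Real.pi, starRingEnd ℂ (c * Complex.exp (m * t * Complex.I)) *
      (d * Complex.exp (n * t * Complex.I)) = 0 := by
  have e : ∀ t : ℝ, starRingEnd ℂ (c * Complex.exp (m * t * Complex.I)) *
      (d * Complex.exp (n * t * Complex.I))
        = starRingEnd ℂ c * d * Complex.exp ((n - m : ℤ) * t * Complex.I) := fun t => by
    rw [map_mul, ← Complex.exp_conj]
    have : Complex.exp ((n - m : ℤ) * t * Complex.I)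
        = Complex.exp (starRingEnd ℂ (m * t * Complex.I)) * Complex.exp (n * t * Complex.I) := by
      rw [← Complex.exp_add]
      congr 1
      simp
      ring
    rw [this]
    ring
  simp only [e]
  rw [intervalIntegral.integral_const_mul, integral_exp_int_mul_I (sub_ne_zero.2 h.symm), mul_zero]

/-- The partial sums have variation at most the mean of their derivative, whose mean square is
bounded by `∑ ‖u k‖ ^ 2`; the variation is lower semicontinuous. -/
theorem boundedVariationOn_powerSumPrimitive {u : ℕ → ℂ} (hu : Summable fun k => ‖u k‖ ^ 2) :
    BoundedVariationOn (fun t : ℝ => powerSumPrimitive u (Complex.exp (t * Complex.I)))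
      (Icc 0 (2 * Real.pi)) := by
  set ψ : ℕ → ℝ → ℂ := fun k t => Complex.I * u k * Complex.exp (((k + 1 : ℕ) : ℤ) * t * Complex.I)
    with hψ
  have hψc : ∀ k, Continuous (ψ k) := fun k => by rw [hψ]; fun_prop
  have hψn : ∀ k t, ‖ψ k t‖ = ‖u k‖ := fun k t => by
    have : ((((k + 1 : ℕ) : ℤ) * t * Complex.I : ℂ))
        = ((((k + 1 : ℕ) : ℝ) * t : ℝ) : ℂ) * Complex.I := by
      push_cast; rfl
    simp only [hψ]
    rw [this, norm_mul, Complex.norm_exp_ofReal_mul_I]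
    simp
  have ho : ∀ j k, j ≠ k → ∫ t in (0)..2 * Real.pi, starRingEnd ℂ (ψ j t) * ψ k t = 0 :=
    fun j k hjk => integral_conj_exp_mul_exp (by exact_mod_cast fun h => hjk (Nat.succ_injective h))
  set h : ℕ → ℝ → ℂ := fun N t =>
    ∑ k ∈ Finset.range N, u k / (k + 1) * Complex.exp (t * Complex.I) ^ (k + 1) with hh
  have hderiv : ∀ N t, HasDerivAt (h N) (∑ k ∈ Finset.range N, ψ k t) t := fun N t => by
    refine HasDerivAt.fun_sum fun k _ => ?_
    have h1 : HasDerivAt (fun t : ℝ => Complex.exp (t * Complex.I))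
        (Complex.exp (t * Complex.I) * Complex.I) t := by
      have := ((Complex.ofRealCLM.hasDerivAt (x := t)).mul_const Complex.I).cexp
      simpa using this
    have hk : ((k : ℂ) + 1) ≠ 0 := by exact_mod_cast Nat.succ_ne_zero k
    refine ((h1.pow (k + 1)).const_mul (u k / (k + 1))).congr_deriv ?_
    have e : Complex.exp (((k + 1 : ℕ) : ℤ) * t * Complex.I)
        = Complex.exp (t * Complex.I) ^ (k + 1) := by
      rw [← Complex.exp_nat_mul]; push_cast; ring_nf
    simp only [hψ]
    rw [e]
    simp only [Nat.add_sub_cancel]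
    push_cast
    field_simp
    ring
  set C : ℝ := Real.pi + Real.pi * ∑' k, ‖u k‖ ^ 2 with hC
  have hint : ∀ N, ∫ t in (0)..2 * Real.pi, ‖∑ k ∈ Finset.range N, ψ k t‖ ≤ C := fun N => by
    have hc : Continuous fun t => ∑ k ∈ Finset.range N, ψ k t :=
      continuous_finsetSum _ fun k _ => hψc k
    -- `x ≤ (1 + x ^ 2) / 2` reduces the mean to the mean square
    calc ∫ t in (0)..2 * Real.pi, ‖∑ k ∈ Finset.range N, ψ k t‖
        ≤ ∫ t in (0)..2 * Real.pi, (1 / 2 + 1 / 2 * ‖∑ k ∈ Finset.range N, ψ k t‖ ^ 2) := by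
          refine intervalIntegral.integral_mono Real.two_pi_pos.le
            (hc.norm.intervalIntegrable _ _) (Continuous.intervalIntegrable (by fun_prop) _ _)
            fun t => ?_
          have := sq_nonneg (‖∑ k ∈ Finset.range N, ψ k t‖ - 1)
          simp only
          linarith
      _ = Real.pi + Real.pi * ∑ k ∈ Finset.range N, ‖u k‖ ^ 2 := by
          rw [intervalIntegral.integral_add (by simp)
              (Continuous.intervalIntegrable (by fun_prop) _ _),
            intervalIntegral.integral_const_mul, integral_norm_sq_sum_eq hψc ho]
          simp only [hψn, intervalIntegral.integral_const, sub_zero, smul_eq_mul]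
          rw [← Finset.mul_sum]
          ring
      _ ≤ C := by
          have := hu.sum_le_tsum (Finset.range N) fun k _ => by positivity
          have := Real.pi_pos
          rw [hC]
          gcongr
  have hlim : ∀ t ∈ Icc 0 (2 * Real.pi), Tendsto (fun N => h N t) atTop
      (𝓝 (powerSumPrimitive u (Complex.exp (t * Complex.I)))) := fun t _ =>
    (Summable.of_norm_bounded (summable_norm_div_succ hu) fun k =>
      norm_powerSumPrimitive_term_le u k
        (by rw [Complex.norm_exp_ofReal_mul_I])).hasSum.tendsto_sum_nat
  refine ne_top_of_le_ne_top (ENNReal.ofReal_ne_top (r := C)) ?_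
  refine le_of_forall_lt fun v hv => ?_
  obtain ⟨N, hN⟩ := (eVariationOn.lowerSemicontinuous_aux hlim hv).exists
  exact hN.trans_le ((eVariationOn_le_integral_norm_deriv (hderiv N)
    (continuous_finsetSum _ fun k _ => hψc k)).trans (ENNReal.ofReal_le_ofReal (hint N)))

/-- If `H` is continuous on the closed disc, holomorphic inside, and its restriction to the circle
has a derivative at a boundary point, then the derivative of `H` has a limit in Stolz regions. -/
theorem exists_tendsto_deriv_stolz {H : ℂ → ℂ} (hH : DiffContOnCl ℂ H (Metric.ball 0 1)) {t : ℝ}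
    (hd : DifferentiableAt ℝ (fun s : ℝ => H (Complex.exp (s * Complex.I))) t) :
    ∃ l : ℂ, ∀ K : ℝ, Tendsto (deriv H) (𝓝[{w | ‖w‖ < 1 ∧
      ‖w - Complex.exp (t * Complex.I)‖ ≤ K * (1 - ‖w‖)}] Complex.exp (t * Complex.I)) (𝓝 l) := by
  set ζ₀ := Complex.exp (t * Complex.I) with hζ₀
  have hn : ‖ζ₀‖ = 1 := Complex.norm_exp_ofReal_mul_I t
  have hz : ζ₀ ≠ 0 := Complex.exp_ne_zero _
  set h' := deriv (fun s : ℝ => H (Complex.exp (s * Complex.I))) t with hh'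
  -- the limit is the derivative of `H` at `ζ₀` along the circle
  set A : ℂ := h' / (Complex.I * ζ₀) with hA
  set D : ℂ → ℂ := fun ζ => H ζ - H ζ₀ - A * (ζ - ζ₀) with hD
  have hDc : DiffContOnCl ℂ D (Metric.ball 0 1) :=
    (hH.sub diffContOnCl_const).sub (Differentiable.diffContOnCl (by fun_prop))
  have hlog : HasDerivAt (fun ζ => Complex.log (ζ / ζ₀)) ζ₀⁻¹ ζ₀ := by
    have h1 : HasDerivAt (fun ζ : ℂ => ζ / ζ₀) (1 / ζ₀) ζ₀ := (hasDerivAt_id ζ₀).div_const ζ₀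
    have := h1.clog (by rw [div_self hz]; exact Complex.one_mem_slitPlane)
    simpa [div_self hz] using this
  have hlogO : (fun ζ => Complex.log (ζ / ζ₀)) =O[𝓝 ζ₀] fun ζ => ζ - ζ₀ := by
    simpa [div_self hz] using hlog.isBigO_sub
  have hlogo : (fun ζ => Complex.log (ζ / ζ₀) - (ζ - ζ₀) * ζ₀⁻¹) =o[𝓝 ζ₀] fun ζ => ζ - ζ₀ := by
    simpa [div_self hz] using hasDerivAt_iff_isLittleO.1 hlog
  set τ : ℂ → ℝ := fun ζ => (Complex.log (ζ / ζ₀)).im with hτ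
  have hτlim : Tendsto (fun ζ => t + τ ζ) (𝓝 ζ₀) (𝓝 t) := by
    have := (Complex.continuous_im.tendsto _).comp hlog.continuousAt.tendsto
    simp only [div_self hz, Complex.log_one, Complex.zero_im] at this
    simpa using this.const_add t
  have hτO : (fun ζ => t + τ ζ - t) =O[𝓝 ζ₀] fun ζ => ζ - ζ₀ := by
    refine Asymptotics.IsBigO.trans (.of_bound 1 (Eventually.of_forall fun ζ => ?_)) hlogO
    rw [add_sub_cancel_left, one_mul]
    exact Complex.abs_im_le_norm _
  have hho : (fun ζ => H (Complex.exp ((t + τ ζ : ℝ) * Complex.I)) - H ζ₀ - (τ ζ : ℂ) * h')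
      =o[𝓝 ζ₀] fun ζ => ζ - ζ₀ := by
    have := (hasDerivAt_iff_isLittleO.1 hd.hasDerivAt).comp_tendsto hτlim
    simpa [Function.comp_def] using this.trans_isBigO hτO
  have hDo : D =o[𝓝[Metric.sphere 0 1] ζ₀] fun ζ => ζ - ζ₀ := by
    have hsum := (hho.add (hlogo.const_mul_left (h' / Complex.I))).mono
      (nhdsWithin_le_nhds (s := Metric.sphere (0 : ℂ) 1))
    refine hsum.congr' ?_ EventuallyEq.rfl
    filter_upwards [self_mem_nhdsWithin] with ζ hζ
    have hζ1 : ‖ζ‖ = 1 := by simpa using hζ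
    have hζ0 : ζ ≠ 0 := norm_ne_zero_iff.1 (by rw [hζ1]; exact one_ne_zero)
    have hL : Complex.log (ζ / ζ₀) = τ ζ * Complex.I := by
      apply Complex.ext
      · simp [Complex.log_re, hζ1, hn]
      · simp [hτ]
    have hexp : Complex.exp ((t + τ ζ : ℝ) * Complex.I) = ζ := by
      have : ((t + τ ζ : ℝ) : ℂ) * Complex.I = t * Complex.I + Complex.log (ζ / ζ₀) := by
        rw [hL]; push_cast; ring
      rw [this, Complex.exp_add, Complex.exp_log (div_ne_zero hζ0 hz), ← hζ₀, mul_div_cancel₀ _ hz]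
    simp only [hD, hA]
    rw [hexp, hL]
    field_simp
    ring
  refine ⟨A, fun K => ?_⟩
  have h0 := (tendsto_deriv_stolz hDc hn hDo K).add_const A
  rw [zero_add] at h0
  refine h0.congr' ?_
  filter_upwards [self_mem_nhdsWithin] with w ⟨hw, _⟩
  have hHw : DifferentiableAt ℂ H w := hH.differentiableAt Metric.isOpen_ball (by simpa using hw)
  have := ((hHw.hasDerivAt.sub_const (H ζ₀)).sub
    (((hasDerivAt_id w).sub_const ζ₀).const_mul A)).deriv
  have e : deriv D w = deriv H w - A * 1 := this
  rw [e]
  ring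

/-- **Fatou's theorem** for the Hardy space `H²` of the unit disc: a power series with square
summable coefficients has nontangential limits almost everywhere on the unit circle. -/
theorem ae_exists_tendsto_powerSum {u : ℕ → ℂ} (hu : Summable fun k => ‖u k‖ ^ 2) :
    ∀ᵐ t : ℝ ∂volume.restrict (Ioc 0 (2 * Real.pi)), ∃ l : ℂ, ∀ K : ℝ,
      Tendsto (powerSum u) (𝓝[{w | ‖w‖ < 1 ∧ ‖w - Complex.exp (t * Complex.I)‖ ≤ K * (1 - ‖w‖)}]
        Complex.exp (t * Complex.I)) (𝓝 l) := by
  have hbv := boundedVariationOn_powerSumPrimitive hu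
  rw [← uIcc_of_le Real.two_pi_pos.le] at hbv
  rw [ae_restrict_iff' measurableSet_Ioc]
  filter_upwards [hbv.ae_differentiableAt_of_mem_uIcc] with t ht htm
  rw [uIcc_of_le Real.two_pi_pos.le] at ht
  obtain ⟨l, hl⟩ := exists_tendsto_deriv_stolz (diffContOnCl_powerSumPrimitive hu)
    (ht (Ioc_subset_Icc_self htm))
  refine ⟨l, fun K => (hl K).congr' ?_⟩
  filter_upwards [self_mem_nhdsWithin] with w hw
  exact deriv_powerSumPrimitive hu hw.1

/-! ### The Joukowski parametrization of the ellipse -/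

/-- The Joukowski map `w ↦ (w + 1 / w) / 2`, which takes the circle of radius `r > 1` to the
boundary of the ellipse with parameter `r ^ 2`. -/
noncomputable def joukowski (w : ℂ) : ℂ := (w + w⁻¹) / 2

theorem joukowski_inv (w : ℂ) : joukowski w⁻¹ = joukowski w := by
  simp [joukowski, add_comm]

theorem norm_joukowski_sub_one_add {w : ℂ} (hw : w ≠ 0) :
    ‖joukowski w - 1‖ + ‖joukowski w + 1‖ = ‖w‖ + ‖w‖⁻¹ := by
  have h1 : joukowski w - 1 = (w - 1) ^ 2 / (2 * w) := by rw [joukowski]; field_simp; ring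
  have h2 : joukowski w + 1 = (w + 1) ^ 2 / (2 * w) := by rw [joukowski]; field_simp; ring
  have hn : 0 < ‖w‖ := norm_pos_iff.2 hw
  have hp := parallelogram_law_with_norm ℝ w 1
  rw [norm_one] at hp
  rw [h1, h2, norm_div, norm_div, norm_pow, norm_pow, norm_mul, Complex.norm_ofNat]
  field_simp
  linarith

theorem exists_joukowski_eq (z : ℂ) : ∃ w : ℂ, 1 ≤ ‖w‖ ∧ joukowski w = z := by
  obtain ⟨s, hs⟩ := IsAlgClosed.exists_pow_nat_eq (z ^ 2 - 1) two_pos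
  have hp : (z + s) * (z - s) = 1 := by linear_combination -hs
  have h1 : z + s ≠ 0 := left_ne_zero_of_mul_eq_one hp
  have hinv : (z + s)⁻¹ = z - s := inv_eq_of_mul_eq_one_right hp
  have hJ : joukowski (z + s) = z := by rw [joukowski, hinv]; ring
  rcases le_total 1 ‖z + s‖ with h | h
  · exact ⟨_, h, hJ⟩
  · refine ⟨(z + s)⁻¹, ?_, by rw [joukowski_inv, hJ]⟩
    rw [norm_inv]
    exact (one_le_inv₀ (norm_pos_iff.2 h1)).2 h

theorem add_inv_lt_add_inv_iff {x y : ℝ} (hx : 1 ≤ x) (hy : 1 ≤ y) : x + x⁻¹ < y + y⁻¹ ↔ x < y := by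
  have hmono : StrictMonoOn (fun x : ℝ => x + x⁻¹) (Ici 1) := by
    intro a ha b hb hab
    have ha' : (1 : ℝ) ≤ a := ha
    have e : (b + b⁻¹) - (a + a⁻¹) = (b - a) * (a * b - 1) / (a * b) := by
      have : b ≠ 0 := by linarith
      field_simp
      ring
    have h1 : 0 < (b - a) * (a * b - 1) / (a * b) :=
      div_pos (mul_pos (by linarith) (by nlinarith)) (by nlinarith)
    simp only
    linarith
  exact hmono.lt_iff_lt hx hy

theorem joukowski_mem_ellipse_iff {θ : ℝ} (hθ : 1 ≤ θ) {w : ℂ} (hw : 1 ≤ ‖w‖) :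
    joukowski w ∈ ellipse θ ↔ ‖w‖ < √θ := by
  have h0 : w ≠ 0 := norm_pos_iff.1 (by linarith)
  rw [ellipse, mem_ofPred_eq, norm_joukowski_sub_one_add h0]
  exact add_inv_lt_add_inv_iff hw (Real.one_le_sqrt.2 hθ)

theorem joukowski_sub_joukowski {w v : ℂ} (hw : w ≠ 0) (hv : v ≠ 0) :
    joukowski w - joukowski v = (w - v) * (1 - (w * v)⁻¹) / 2 := by
  rw [joukowski, joukowski]
  field_simp
  ring

theorem norm_joukowski_sub_le {w v : ℂ} (hw : 1 ≤ ‖w‖) (hv : 1 ≤ ‖v‖) :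
    ‖joukowski w - joukowski v‖ ≤ ‖w - v‖ := by
  have hw0 : w ≠ 0 := norm_pos_iff.1 (by linarith)
  have hv0 : v ≠ 0 := norm_pos_iff.1 (by linarith)
  have h1 : ‖1 - (w * v)⁻¹‖ ≤ 2 := by
    refine (norm_sub_le _ _).trans ?_
    rw [norm_one, norm_inv, norm_mul]
    have : (‖w‖ * ‖v‖)⁻¹ ≤ 1 := inv_le_one_of_one_le₀ (by nlinarith)
    linarith
  rw [joukowski_sub_joukowski hw0 hv0, norm_div, norm_mul, Complex.norm_ofNat]
  nlinarith [norm_nonneg (w - v)]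

theorem norm_sub_le_norm_joukowski_sub {R : ℝ} (hR : 1 < R) {w v : ℂ} (hw : 1 ≤ ‖w‖)
    (hv : ‖v‖ = R) : (1 - R⁻¹) * ‖w - v‖ ≤ 2 * ‖joukowski w - joukowski v‖ := by
  have hw0 : w ≠ 0 := norm_pos_iff.1 (by linarith)
  have hv0 : v ≠ 0 := norm_pos_iff.1 (by linarith)
  have h1 : 1 - R⁻¹ ≤ ‖1 - (w * v)⁻¹‖ := by
    refine le_trans ?_ (norm_sub_norm_le _ _)
    rw [norm_one, norm_inv, norm_mul, hv]
    have : (‖w‖ * R)⁻¹ ≤ R⁻¹ := inv_anti₀ (by linarith) (by nlinarith)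
    linarith
  rw [joukowski_sub_joukowski hw0 hv0, norm_div, norm_mul, Complex.norm_ofNat]
  nlinarith [norm_nonneg (w - v)]

theorem joukowski_injOn : InjOn joukowski {w | 1 < ‖w‖} := by
  intro w (hw : 1 < ‖w‖) v (hv : 1 < ‖v‖) h
  have := norm_sub_le_norm_joukowski_sub hv hw.le rfl
  rw [h, sub_self, norm_zero, mul_zero] at this
  have h1 : 0 < 1 - ‖v‖⁻¹ := sub_pos.2 (inv_lt_one_of_one_lt₀ hv)
  have h2 : ‖w - v‖ ≤ 0 := by
    by_contra! h3
    nlinarith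
  exact sub_eq_zero.1 (norm_le_zero_iff.1 h2)

theorem norm_circleMap_zero_of_nonneg {r : ℝ} (hr : 0 ≤ r) (t : ℝ) : ‖circleMap 0 r t‖ = r := by
  rw [norm_circleMap_zero, abs_of_nonneg hr]

theorem norm_circleMap_zero_sub (r r' t : ℝ) :
    ‖circleMap 0 r t - circleMap 0 r' t‖ = |r - r'| := by
  rw [circleMap_zero, circleMap_zero, ← sub_mul, ← Complex.ofReal_sub, ← circleMap_zero,
    norm_circleMap_zero]

theorem exists_circleMap_zero_eq (w : ℂ) : ∃ t, circleMap 0 ‖w‖ t = w :=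
  ⟨w.arg, by rw [circleMap_zero, Complex.norm_mul_exp_arg_mul_I]⟩

theorem ellipseParam_eq {θ : ℝ} (hθ : 0 < θ) (t : ℝ) :
    ellipseParam θ t = joukowski (circleMap 0 (√θ) t) := by
  have h : (√θ : ℂ) ≠ 0 := by exact_mod_cast (Real.sqrt_pos.2 hθ).ne'
  rw [joukowski, circleMap_zero, mul_inv, ← Complex.exp_neg, ← neg_mul, Complex.exp_mul_I,
    Complex.exp_mul_I, ellipseParam]
  push_cast
  rw [Complex.cos_neg, Complex.sin_neg]
  ring

theorem continuous_ellipseParam (θ : ℝ) : Continuous (ellipseParam θ) := by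
  unfold ellipseParam; fun_prop

theorem hasDerivAt_ellipseParam {θ : ℝ} (hθ : 0 < θ) (t : ℝ) :
    HasDerivAt (ellipseParam θ)
      (Complex.I * (circleMap 0 (√θ) t - (circleMap 0 (√θ) t)⁻¹) / 2) t := by
  have h : (√θ : ℂ) ≠ 0 := by exact_mod_cast (Real.sqrt_pos.2 hθ).ne'
  have e : ellipseParam θ = fun s : ℝ => (√θ * Complex.exp (s * Complex.I)
      + (√θ : ℂ)⁻¹ * Complex.exp (-(s * Complex.I))) / 2 := by
    ext s
    rw [ellipseParam_eq hθ, joukowski, circleMap_zero, mul_inv, Complex.exp_neg]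
  have h0 : HasDerivAt (fun s : ℝ => (s : ℂ) * Complex.I) Complex.I t := by
    simpa using (Complex.ofRealCLM.hasDerivAt (x := t)).mul_const Complex.I
  rw [e]
  refine (((h0.cexp.const_mul (√θ : ℂ)).add (h0.neg.cexp.const_mul (√θ : ℂ)⁻¹)).div_const
    2).congr_deriv ?_
  rw [circleMap_zero, mul_inv, ← Complex.exp_neg, Pi.neg_apply]
  ring

theorem sqrt_gt_one {θ : ℝ} (hθ : 1 < θ) : 1 < √θ := by
  rw [Real.lt_sqrt] <;> linarith

theorem ellipseParam_injOn {θ : ℝ} (hθ : 1 < θ) : InjOn (ellipseParam θ) (Ioc 0 (2 * Real.pi)) := by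
  have hR := sqrt_gt_one hθ
  intro s hs t ht h
  rw [ellipseParam_eq (by linarith), ellipseParam_eq (by linarith)] at h
  have hn : ∀ t, circleMap 0 (√θ) t ∈ {w : ℂ | 1 < ‖w‖} := fun t => by
    rw [mem_ofPred_eq, norm_circleMap_zero_of_nonneg (by positivity)]; exact hR
  refine injOn_circleMap_of_abs_sub_le (a := 0) (b := 2 * Real.pi) (by linarith : √θ ≠ 0) ?_ ?_ ?_
    (joukowski_injOn (hn s) (hn t) h)
  · rw [zero_sub, abs_neg, abs_of_pos Real.two_pi_pos]
  · rwa [uIoc_of_le Real.two_pi_pos.le]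
  · rwa [uIoc_of_le Real.two_pi_pos.le]

/-! ### Arc length and the Chebyshev weight -/

theorem chebyshevWeight_ellipseParam_mul {θ : ℝ} (hθ : 1 < θ) (t : ℝ) :
    chebyshevWeight (ellipseParam θ t) * ‖deriv (ellipseParam θ) t‖ = 1 := by
  have hR := sqrt_gt_one hθ
  have h0 : 0 < θ := by linarith
  set w := circleMap 0 (√θ) t with hw
  have hn : ‖w‖ = √θ := norm_circleMap_zero_of_nonneg (by positivity) t
  have hw0 : w ≠ 0 := norm_pos_iff.1 (by linarith)
  have hd : 0 < ‖w - w⁻¹‖ := by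
    refine lt_of_lt_of_le ?_ (norm_sub_norm_le _ _)
    rw [norm_inv, hn]
    have := inv_lt_one_of_one_lt₀ hR
    linarith
  have e : joukowski w ^ 2 - 1 = ((w - w⁻¹) / 2) ^ 2 := by
    rw [joukowski]; field_simp; ring
  rw [(hasDerivAt_ellipseParam h0 t).deriv, ellipseParam_eq h0, ← hw, chebyshevWeight, e, norm_pow,
    ← Real.rpow_natCast, ← Real.rpow_mul (norm_nonneg _)]
  have h2 : ((2 : ℕ) : ℝ) * -(1 / 2) = -1 := by norm_num
  rw [h2, Real.rpow_neg_one, norm_div, norm_div, norm_mul, Complex.norm_I, one_mul]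
  have : ‖(2 : ℂ)‖ = 2 := by simp
  rw [this]
  exact inv_mul_cancel₀ (by positivity)

theorem measurable_enorm_deriv_ellipseParam (θ : ℝ) :
    Measurable fun t => ‖deriv (ellipseParam θ) t‖ₑ :=
  (measurable_deriv _).enorm

theorem measurable_chebyshevWeight : Measurable chebyshevWeight := by
  unfold chebyshevWeight; fun_prop

/-- In the Joukowski parametrization the weighted arc length is Lebesgue measure `dt`. -/
theorem weightedArcLength_eq_map {θ : ℝ} (hθ : 1 < θ) :
    weightedArcLength θ chebyshevWeight
      = Measure.map (ellipseParam θ) (volume.restrict (Ioc 0 (2 * Real.pi))) := by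
  have hm := (continuous_ellipseParam θ).measurable
  have hw : Measurable fun z => ENNReal.ofReal (chebyshevWeight z) :=
    measurable_chebyshevWeight.ennreal_ofReal
  ext s hs
  rw [weightedArcLength, arcLength, withDensity_apply _ hs, setLIntegral_map hs hw hm,
    setLIntegral_withDensity_eq_setLIntegral_mul _ (measurable_enorm_deriv_ellipseParam θ)
      (g := fun t => ENNReal.ofReal (chebyshevWeight (ellipseParam θ t))) (hw.comp hm) (hm hs),
    Measure.map_apply hm hs]
  have e : ∀ t, ((fun t => ‖deriv (ellipseParam θ) t‖ₑ) *
      fun t => ENNReal.ofReal (chebyshevWeight (ellipseParam θ t))) t = 1 := fun t => by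
    rw [Pi.mul_apply, ← ofReal_norm, ← ENNReal.ofReal_mul (norm_nonneg _), mul_comm,
      chebyshevWeight_ellipseParam_mul hθ, ENNReal.ofReal_one]
  rw [lintegral_congr e]
  simp

theorem lintegral_arcLength (θ : ℝ) {g : ℂ → ENNReal} (hg : Measurable g) :
    ∫⁻ z, g z ∂(arcLength θ) = ∫⁻ t in Ioc 0 (2 * Real.pi),
      ‖deriv (ellipseParam θ) t‖ₑ * g (ellipseParam θ t) := by
  have hm := (continuous_ellipseParam θ).measurable
  rw [arcLength, lintegral_map hg hm, lintegral_withDensity_eq_lintegral_mul _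
    (measurable_enorm_deriv_ellipseParam θ) (g := fun t => g (ellipseParam θ t)) (hg.comp hm)]
  rfl

/-- A property of points that holds for almost every value of the parameter holds almost everywhere
with respect to arc length; the injectivity of the parametrization makes this true without any
measurability of the property. -/
theorem ae_arcLength_of_ae {θ : ℝ} (hθ : 1 < θ) {p : ℂ → Prop}
    (h : ∀ᵐ t ∂volume.restrict (Ioc 0 (2 * Real.pi)), p (ellipseParam θ t)) :
    ∀ᵐ ζ ∂(arcLength θ), p ζ := by
  have hm := (continuous_ellipseParam θ).measurable
  have hinj := ellipseParam_injOn hθ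
  set I := Ioc 0 (2 * Real.pi) with hI
  obtain ⟨B, hBs, hB, hB0⟩ := exists_measurable_superset_of_null (ae_iff.1 h)
  set N : Set ℂ := (ellipseParam θ '' I)ᶜ ∪ ellipseParam θ '' (B ∩ I) with hN
  have hNm : MeasurableSet N :=
    (measurableSet_Ioc.image_of_measurable_injOn hm hinj).compl.union
      ((hB.inter measurableSet_Ioc).image_of_measurable_injOn hm (hinj.mono inter_subset_right))
  refine measure_mono_null (t := N) (fun ζ hζ => ?_) ?_
  · by_cases hi : ζ ∈ ellipseParam θ '' I
    · obtain ⟨t, ht, rfl⟩ := hi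
      exact Or.inr ⟨t, ⟨hBs hζ, ht⟩, rfl⟩
    · exact Or.inl hi
  · rw [arcLength, Measure.map_apply hm hNm]
    refine withDensity_absolutelyContinuous _ _ ?_
    rw [Measure.restrict_apply (hm hNm)]
    rw [Measure.restrict_apply hB] at hB0
    refine measure_mono_null (fun t ht => ?_) hB0
    obtain ⟨h1 | ⟨s, hs, hst⟩, h2⟩ := ht
    · exact absurd (mem_image_of_mem _ h2) h1
    · rwa [← hinj hs.2 h2 hst]

/-! ### Nontangential approach in the Joukowski parametrization -/

theorem joukowski_mem_frontier {θ : ℝ} (hθ : 1 < θ) {w : ℂ} (hw : ‖w‖ = √θ) :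
    joukowski w ∈ frontier (ellipse θ) := by
  have hR := sqrt_gt_one hθ
  have hw0 : w ≠ 0 := norm_pos_iff.1 (by linarith)
  rw [(isOpen_ellipse θ).frontier_eq]
  refine ⟨?_, fun h => ?_⟩
  · have hcont : ContinuousAt (fun s : ℝ => joukowski (s * w)) 1 := by
      unfold joukowski
      refine ContinuousAt.div_const (ContinuousAt.add (by fun_prop)
        (ContinuousAt.inv₀ (by fun_prop) (by simpa using hw0))) _
    have ht : Tendsto (fun s : ℝ => joukowski (s * w)) (𝓝[<] 1) (𝓝 (joukowski w)) := by
      have := hcont.tendsto.mono_left (nhdsWithin_le_nhds (s := Iio 1))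
      simpa using this
    refine mem_closure_of_tendsto ht ?_
    have h1 : (√θ)⁻¹ < 1 := inv_lt_one_of_one_lt₀ hR
    filter_upwards [Ioo_mem_nhdsLT h1] with s hs
    have hs0 : 0 < s := lt_trans (by positivity) hs.1
    have hn : ‖(s : ℂ) * w‖ = s * √θ := by
      rw [norm_mul, Complex.norm_real, Real.norm_of_nonneg hs0.le, hw]
    refine (joukowski_mem_ellipse_iff hθ.le ?_).2 ?_
    · rw [hn]
      have := hs.1
      rw [inv_lt_iff_one_lt_mul₀ (by linarith)] at this
      linarith
    · rw [hn]
      nlinarith [hs.2]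
  · have := (joukowski_mem_ellipse_iff hθ.le (by linarith)).1 h
    linarith

theorem ellipseParam_mem_frontier {θ : ℝ} (hθ : 1 < θ) (t : ℝ) :
    ellipseParam θ t ∈ frontier (ellipse θ) := by
  rw [ellipseParam_eq (by linarith)]
  exact joukowski_mem_frontier hθ (norm_circleMap_zero_of_nonneg (by positivity) t)

theorem norm_add_norm_of_mem_frontier {θ : ℝ} {z : ℂ} (hz : z ∈ frontier (ellipse θ)) :
    ‖z - 1‖ + ‖z + 1‖ = √θ + (√θ)⁻¹ :=
  frontier_lt_subset_eq (f := fun z : ℂ => ‖z - 1‖ + ‖z + 1‖) (g := fun _ => √θ + (√θ)⁻¹)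
    (by fun_prop) continuous_const hz

theorem stolz_of_mem_approachRegion {θ κ : ℝ} (hθ : 1 < θ) {w w₀ : ℂ} (hw : 1 ≤ ‖w‖)
    (hw₀ : ‖w₀‖ = √θ) (h : joukowski w ∈ approachRegion θ κ (joukowski w₀)) :
    ‖w‖ < √θ ∧ (1 - (√θ)⁻¹) * ‖w - w₀‖ ≤ 2 * |κ| * (√θ - ‖w‖) := by
  have hR := sqrt_gt_one hθ
  obtain ⟨h1, h2⟩ := h
  have hlt := (joukowski_mem_ellipse_iff hθ.le hw).1 h1
  refine ⟨hlt, (norm_sub_le_norm_joukowski_sub hR hw hw₀).trans ?_⟩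
  obtain ⟨t, ht⟩ := exists_circleMap_zero_eq w
  have hn : ‖circleMap 0 (√θ) t‖ = √θ := norm_circleMap_zero_of_nonneg (by positivity) t
  -- the distance to the boundary is at most the distance to its point in the same direction
  have h3 : Metric.infDist (joukowski w) (frontier (ellipse θ)) ≤ √θ - ‖w‖ := by
    refine (Metric.infDist_le_dist_of_mem (joukowski_mem_frontier hθ hn)).trans ?_
    rw [dist_eq_norm]
    refine (norm_joukowski_sub_le hw (by linarith)).trans ?_
    nth_rewrite 1 [← ht]
    rw [norm_circleMap_zero_sub, abs_sub_comm, abs_of_pos (by linarith)]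
  rw [dist_eq_norm] at h2
  have h4 : κ * Metric.infDist (joukowski w) (frontier (ellipse θ)) ≤ |κ| * (√θ - ‖w‖) :=
    mul_le_mul (le_abs_self κ) h3 Metric.infDist_nonneg (abs_nonneg κ)
  linarith

/-- Nontangential limits at the boundary of the ellipse follow from limits in Stolz regions in the
Joukowski parameter. -/
theorem tendsto_nonTangential_of_stolz {θ : ℝ} (hθ : 1 < θ) {F G : ℂ → ℂ}
    (hFG : ∀ w, 1 ≤ ‖w‖ → ‖w‖ < √θ → F (joukowski w) = G w) {w₀ l : ℂ} (hw₀ : ‖w₀‖ = √θ)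
    (hG : ∀ K : ℝ, Tendsto G
      (𝓝[{w | 1 ≤ ‖w‖ ∧ ‖w‖ < √θ ∧ ‖w - w₀‖ ≤ K * (√θ - ‖w‖)}] w₀) (𝓝 l)) :
    Tendsto F (nonTangential θ (joukowski w₀)) (𝓝 l) := by
  have hR := sqrt_gt_one hθ
  have hc : 0 < 1 - (√θ)⁻¹ := sub_pos.2 (inv_lt_one_of_one_lt₀ hR)
  choose σ hσ1 hσJ using exists_joukowski_eq
  refine tendsto_iSup.2 fun κ => ?_
  have hstolz : ∀ z ∈ approachRegion θ κ (joukowski w₀), ‖σ z‖ < √θ ∧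
      (1 - (√θ)⁻¹) * ‖σ z - w₀‖ ≤ 2 * |κ| * (√θ - ‖σ z‖) := fun z hz =>
    stolz_of_mem_approachRegion hθ (hσ1 z) hw₀ (by rwa [hσJ])
  have hσlim : Tendsto σ (𝓝 (joukowski w₀)) (𝓝 w₀) := by
    rw [tendsto_iff_norm_sub_tendsto_zero]
    have hb : ∀ z, ‖σ z - w₀‖ ≤ 2 / (1 - (√θ)⁻¹) * ‖z - joukowski w₀‖ := fun z => by
      have := norm_sub_le_norm_joukowski_sub hR (hσ1 z) hw₀
      rw [hσJ] at this
      rw [div_mul_eq_mul_div, le_div_iff₀ hc]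
      linarith
    refine squeeze_zero (fun z => norm_nonneg _) hb ?_
    have : Continuous fun z => 2 / (1 - (√θ)⁻¹) * ‖z - joukowski w₀‖ := by fun_prop
    simpa using this.tendsto (joukowski w₀)
  have hlim := (hG (2 * |κ| / (1 - (√θ)⁻¹))).comp
    (tendsto_nhdsWithin_iff.2 ⟨hσlim.mono_left
      (nhdsWithin_le_nhds (s := approachRegion θ κ (joukowski w₀))), by
      filter_upwards [self_mem_nhdsWithin] with z hz
      refine ⟨hσ1 z, (hstolz z hz).1, ?_⟩
      rw [div_mul_eq_mul_div, le_div_iff₀ hc]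
      linarith [(hstolz z hz).2]⟩)
  refine hlim.congr' ?_
  filter_upwards [self_mem_nhdsWithin] with z hz
  have := hFG (σ z) (hσ1 z) (hstolz z hz).1
  rw [hσJ] at this
  exact this.symm

/-- The confocal hyperbolas approach the boundary of the ellipse nontangentially. -/
theorem tendsto_joukowski_circleMap_nonTangential {θ : ℝ} (hθ : 1 < θ) (t : ℝ) :
    Tendsto (fun r => joukowski (circleMap 0 r t)) (𝓝[<] √θ)
      (nonTangential θ (ellipseParam θ t)) := by
  have hR := sqrt_gt_one hθ
  have hc : 0 < 1 - (√θ)⁻¹ := sub_pos.2 (inv_lt_one_of_one_lt₀ hR)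
  have hn : ‖circleMap 0 (√θ) t‖ = √θ := norm_circleMap_zero_of_nonneg (by positivity) t
  rw [ellipseParam_eq (by linarith)]
  set κ : ℝ := 4 / (1 - (√θ)⁻¹) with hκ
  refine Tendsto.mono_right ?_
    (le_iSup (fun κ : ℝ => 𝓝[approachRegion θ κ (joukowski (circleMap 0 (√θ) t))] _) κ)
  have hdist : ∀ r, 1 ≤ r → r < √θ →
      ‖joukowski (circleMap 0 r t) - joukowski (circleMap 0 (√θ) t)‖ ≤ √θ - r := fun r h1 h2 => by
    refine (norm_joukowski_sub_le ?_ (by linarith)).trans ?_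
    · rwa [norm_circleMap_zero_of_nonneg (by linarith)]
    · rw [norm_circleMap_zero_sub, abs_sub_comm, abs_of_pos (by linarith)]
  have hev : ∀ᶠ r in 𝓝[<] √θ, 1 ≤ r ∧ r < √θ := by
    filter_upwards [Ioo_mem_nhdsLT hR] with r hr
    exact ⟨hr.1.le, hr.2⟩
  refine tendsto_nhdsWithin_iff.2 ⟨?_, ?_⟩
  · rw [tendsto_iff_norm_sub_tendsto_zero]
    refine squeeze_zero' (g := fun r => √θ - r) (Eventually.of_forall fun r => norm_nonneg _) ?_ ?_
    · filter_upwards [hev] with r hr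
      exact hdist r hr.1 hr.2
    · have : Continuous fun r : ℝ => √θ - r := by fun_prop
      simpa using (this.tendsto (√θ)).mono_left (nhdsWithin_le_nhds (s := Iio √θ))
  · filter_upwards [hev] with r ⟨h1, h2⟩
    have hnr : ‖circleMap 0 r t‖ = r := norm_circleMap_zero_of_nonneg (by linarith) t
    refine ⟨(joukowski_mem_ellipse_iff hθ.le (by rwa [hnr])).2 (by rwa [hnr]), ?_⟩
    -- the sum of the distances to the foci is 2-Lipschitz
    have hinf : (√θ - r) * (1 - (√θ)⁻¹) / 2
        ≤ Metric.infDist (joukowski (circleMap 0 r t)) (frontier (ellipse θ)) := by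
      refine (Metric.le_infDist ⟨_, joukowski_mem_frontier hθ hn⟩).2 fun v hv => ?_
      have e1 := norm_add_norm_of_mem_frontier hv
      have e2 := norm_joukowski_sub_one_add (w := circleMap 0 r t)
        (norm_pos_iff.1 (by rw [hnr]; linarith))
      rw [hnr] at e2
      have e3 : ‖v - 1‖ ≤ ‖v - joukowski (circleMap 0 r t)‖ + ‖joukowski (circleMap 0 r t) - 1‖ :=
        norm_sub_le_norm_sub_add_norm_sub ..
      have e4 : ‖v + 1‖
          ≤ ‖v - joukowski (circleMap 0 r t)‖ + ‖joukowski (circleMap 0 r t) + 1‖ := by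
        refine le_trans (le_of_eq ?_) (norm_add_le _ _)
        congr 1
        ring
      have e5 : (√θ - r) * (1 - (√θ)⁻¹) ≤ √θ + (√θ)⁻¹ - (r + r⁻¹) := by
        have : √θ + (√θ)⁻¹ - (r + r⁻¹) = (√θ - r) * (1 - (√θ)⁻¹ * r⁻¹) := by
          field_simp
          ring
        rw [this]
        have h3 : (√θ)⁻¹ * r⁻¹ ≤ (√θ)⁻¹ :=
          mul_le_of_le_one_right (by positivity) (inv_le_one_of_one_le₀ h1)
        exact mul_le_mul_of_nonneg_left (by linarith) (by linarith)
      rw [dist_comm, dist_eq_norm]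
      linarith
    rw [dist_eq_norm]
    calc _ ≤ √θ - r := hdist r h1 h2
      _ < 2 * (√θ - r) := by linarith
      _ = κ * ((√θ - r) * (1 - (√θ)⁻¹) / 2) := by
        rw [hκ, div_mul_eq_mul_div, eq_div_iff hc.ne']; ring
      _ ≤ _ := mul_le_mul_of_nonneg_left hinf (by positivity)

/-! ### The normalized Chebyshev polynomials on the ellipse -/

/-- The Chebyshev polynomial `𝕋_k`, normalized in the Szegő space of the ellipse. -/
noncomputable def normalizedChebyshev (θ : ℝ) (k : ℕ) (z : ℂ) : ℂ :=
  (((θ ^ k + (θ ^ k)⁻¹) ^ (-(1 / 2) : ℝ) : ℝ) : ℂ) * (orthonormalChebyshev k).eval z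

/-- The factor `m` for which the `k`-th normalized Chebyshev polynomial is `m (w ^ k + w ^ (-k))`
in the Joukowski parameter `w`. -/
noncomputable def joukowskiCoeff (θ : ℝ) (k : ℕ) : ℝ :=
  (θ ^ k + (θ ^ k)⁻¹) ^ (-(1 / 2) : ℝ) * (if k = 0 then √(1 / Real.pi) else √(2 / Real.pi)) / 2

theorem eval_chebyshevT_joukowski (k : ℕ) {w : ℂ} (hw : w ≠ 0) :
    (Polynomial.Chebyshev.T ℂ k).eval (joukowski w) = (w ^ k + (w ^ k)⁻¹) / 2 := by
  have hcos : ∀ n : ℕ, Complex.cos (n * (-Complex.I * Complex.log w))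
      = (w ^ n + (w ^ n)⁻¹) / 2 := by
    intro n
    have e : (n * (-Complex.I * Complex.log w)) * Complex.I = n * Complex.log w := by
      linear_combination (-(n : ℂ) * Complex.log w) * Complex.I_sq
    rw [Complex.cos, neg_mul (_ * _ : ℂ), e, Complex.exp_neg, Complex.exp_nat_mul,
      Complex.exp_log hw]
  have h1 := hcos 1
  simp only [Nat.cast_one, one_mul, pow_one] at h1
  rw [joukowski, ← h1, Polynomial.Chebyshev.T_complex_cos]
  exact_mod_cast hcos k

theorem normalizedChebyshev_joukowski (θ : ℝ) (k : ℕ) {w : ℂ} (hw : w ≠ 0) :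
    normalizedChebyshev θ k (joukowski w) = joukowskiCoeff θ k * (w ^ k + (w ^ k)⁻¹) := by
  rw [normalizedChebyshev, orthonormalChebyshev, Polynomial.eval_mul, Polynomial.eval_C,
    eval_chebyshevT_joukowski k hw, joukowskiCoeff]
  push_cast
  ring

theorem continuous_normalizedChebyshev (θ : ℝ) (k : ℕ) : Continuous (normalizedChebyshev θ k) := by
  unfold normalizedChebyshev
  exact continuous_const.mul (Polynomial.continuous _)

theorem differentiable_normalizedChebyshev (θ : ℝ) (k : ℕ) :
    Differentiable ℂ (normalizedChebyshev θ k) := by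
  unfold normalizedChebyshev
  exact (Polynomial.differentiable _).const_mul _

theorem joukowskiCoeff_pos {θ : ℝ} (hθ : 0 < θ) (k : ℕ) : 0 < joukowskiCoeff θ k := by
  unfold joukowskiCoeff
  have : 0 < (if k = 0 then √(1 / Real.pi) else √(2 / Real.pi)) := by
    have := Real.pi_pos
    split_ifs <;> positivity
  positivity

theorem joukowskiCoeff_sq {θ : ℝ} (hθ : 0 < θ) (k : ℕ) :
    joukowskiCoeff θ k ^ 2 * (θ ^ k + (θ ^ k)⁻¹)
      = if k = 0 then 1 / (4 * Real.pi) else 1 / (2 * Real.pi) := by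
  have hx : 0 < θ ^ k + (θ ^ k)⁻¹ := by positivity
  have h1 : ((θ ^ k + (θ ^ k)⁻¹) ^ (-(1 / 2) : ℝ)) ^ 2 = (θ ^ k + (θ ^ k)⁻¹)⁻¹ := by
    rw [← Real.rpow_natCast, ← Real.rpow_mul hx.le]
    norm_num
    rw [Real.rpow_neg_one]
  rw [joukowskiCoeff, div_pow, mul_pow, h1]
  have hpi := Real.pi_pos
  split_ifs
  · rw [Real.sq_sqrt (by positivity)]
    field_simp
    norm_num
  · rw [Real.sq_sqrt (by positivity)]
    field_simp

theorem joukowskiCoeff_mul_pow_le {θ : ℝ} (hθ : 0 < θ) (k : ℕ) :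
    2 * joukowskiCoeff θ k * √θ ^ k ≤ 1 := by
  have h0 := (joukowskiCoeff_pos hθ k).le
  refine (sq_le_one_iff₀ (by positivity)).1 ?_
  have h1 := joukowskiCoeff_sq hθ k
  have h2 : joukowskiCoeff θ k ^ 2 * (θ ^ k + (θ ^ k)⁻¹) ≤ 1 / 4 := by
    rw [h1]
    have := Real.pi_gt_three
    split_ifs
    · rw [div_le_div_iff₀ (by positivity) (by norm_num)]; linarith
    · rw [div_le_div_iff₀ (by positivity) (by norm_num)]; linarith
  have h3 : (√θ ^ k) ^ 2 = θ ^ k := by rw [← pow_mul, mul_comm, pow_mul, Real.sq_sqrt hθ.le]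
  have h4 : 0 ≤ joukowskiCoeff θ k ^ 2 * (θ ^ k)⁻¹ := by positivity
  rw [mul_pow, mul_pow, h3]
  linarith

/-! ### Orthogonality on the confocal ellipses -/

theorem normalizedChebyshev_joukowski_circleMap (θ : ℝ) (k : ℕ) {r : ℝ} (hr : 0 < r) (t : ℝ) :
    normalizedChebyshev θ k (joukowski (circleMap 0 r t))
      = ((joukowskiCoeff θ k * r ^ k : ℝ) : ℂ) * Complex.exp ((k : ℤ) * t * Complex.I)
        + ((joukowskiCoeff θ k * (r ^ k)⁻¹ : ℝ) : ℂ) *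
          Complex.exp ((-k : ℤ) * t * Complex.I) := by
  have hw : circleMap 0 r t ≠ 0 := norm_pos_iff.1 (by
    rw [norm_circleMap_zero_of_nonneg hr.le]; exact hr)
  have e : Complex.exp ((-k : ℤ) * t * Complex.I) = (Complex.exp ((k : ℤ) * t * Complex.I))⁻¹ := by
    rw [← Complex.exp_neg]; push_cast; ring_nf
  have e2 : Complex.exp ((k : ℤ) * t * Complex.I) = Complex.exp (t * Complex.I) ^ k := by
    rw [← Complex.exp_nat_mul]; push_cast; ring_nf
  rw [normalizedChebyshev_joukowski θ k hw, e, e2, circleMap_zero, mul_pow, mul_inv]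
  push_cast
  ring

theorem continuous_normalizedChebyshev_joukowski (θ : ℝ) (k : ℕ) {r : ℝ} (hr : 0 < r) :
    Continuous fun t => normalizedChebyshev θ k (joukowski (circleMap 0 r t)) := by
  simp only [normalizedChebyshev_joukowski_circleMap θ k hr]
  fun_prop

theorem integral_conj_normalizedChebyshev_mul (θ : ℝ) {r : ℝ} (hr : 0 < r) {j k : ℕ} (hjk : j ≠ k) :
    ∫ t in (0)..2 * Real.pi,
      starRingEnd ℂ (normalizedChebyshev θ j (joukowski (circleMap 0 r t))) *
        normalizedChebyshev θ k (joukowski (circleMap 0 r t)) = 0 := by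
  have hi : ∀ (c d : ℂ) (m n : ℤ), IntervalIntegrable (fun t : ℝ =>
      starRingEnd ℂ (c * Complex.exp (m * t * Complex.I)) * (d * Complex.exp (n * t * Complex.I)))
      volume 0 (2 * Real.pi) := fun c d m n =>
    Continuous.intervalIntegrable
      ((Complex.continuous_conj.comp (by fun_prop)).mul (by fun_prop)) _ _
  simp only [normalizedChebyshev_joukowski_circleMap _ _ hr, map_add, add_mul, mul_add]
  rw [intervalIntegral.integral_add ((hi _ _ _ _).add (hi _ _ _ _)) ((hi _ _ _ _).add (hi _ _ _ _)),
    intervalIntegral.integral_add (hi _ _ _ _) (hi _ _ _ _),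
    intervalIntegral.integral_add (hi _ _ _ _) (hi _ _ _ _)]
  rw [integral_conj_exp_mul_exp (by omega), integral_conj_exp_mul_exp (by omega),
    integral_conj_exp_mul_exp (by omega), integral_conj_exp_mul_exp (by omega)]
  simp

/-- The mean square of a normalized Chebyshev polynomial over the ellipse with parameter `r ^ 2`. -/
theorem integral_norm_sq_normalizedChebyshev {θ : ℝ} (hθ : 0 < θ) {r : ℝ} (hr : 0 < r) (k : ℕ) :
    ∫ t in (0)..2 * Real.pi, ‖normalizedChebyshev θ k (joukowski (circleMap 0 r t))‖ ^ 2
      = ((r ^ 2) ^ k + ((r ^ 2) ^ k)⁻¹) / (θ ^ k + (θ ^ k)⁻¹) := by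
  have hm := joukowskiCoeff_sq hθ k
  have hx : 0 < θ ^ k + (θ ^ k)⁻¹ := by positivity
  have hpi := Real.pi_pos
  simp only [normalizedChebyshev_joukowski_circleMap _ _ hr]
  rw [eq_div_iff hx.ne']
  rcases Nat.eq_zero_or_pos k with rfl | hk
  · simp only [pow_zero, inv_one, if_true, mul_one, Nat.cast_zero, Int.cast_zero, neg_zero,
      zero_mul, Complex.exp_zero, ← Complex.ofReal_add, Complex.norm_real, Real.norm_eq_abs,
      sq_abs, intervalIntegral.integral_const, sub_zero, smul_eq_mul] at hm ⊢
    field_simp at hm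
    nlinarith
  · rw [if_neg hk.ne'] at hm
    set m := joukowskiCoeff θ k with hmdef
    set ψ : Bool → ℝ → ℂ := fun b t => if b
      then ((m * r ^ k : ℝ) : ℂ) * Complex.exp ((k : ℤ) * t * Complex.I)
      else ((m * (r ^ k)⁻¹ : ℝ) : ℂ) * Complex.exp ((-k : ℤ) * t * Complex.I) with hψ
    have hc : ∀ b, Continuous (ψ b) := fun b => by
      cases b <;> simp only [hψ, if_true, Bool.false_eq_true, if_false] <;> fun_prop
    have ho : ∀ i j, i ≠ j → ∫ t in (0)..2 * Real.pi, starRingEnd ℂ (ψ i t) * ψ j t = 0 := by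
      intro i j hij
      cases i <;> cases j <;> first | exact absurd rfl hij | skip
      · exact integral_conj_exp_mul_exp (by omega)
      · exact integral_conj_exp_mul_exp (by omega)
    have hne : ∀ (c : ℝ) (n : ℤ) (t : ℝ),
        ‖(c : ℂ) * Complex.exp (n * t * Complex.I)‖ ^ 2 = c ^ 2 := by
      intro c n t
      have : (n * t * Complex.I : ℂ) = ((n * t : ℝ) : ℂ) * Complex.I := by push_cast; rfl
      rw [this, norm_mul, Complex.norm_exp_ofReal_mul_I, Complex.norm_real, mul_one,
        Real.norm_eq_abs, sq_abs]
    have h := integral_norm_sq_sum_eq hc ho Finset.univ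
    simp only [Fintype.sum_bool, hψ, if_true, Bool.false_eq_true, if_false, hne,
      intervalIntegral.integral_const, sub_zero, smul_eq_mul] at h
    rw [h, ← mul_add, mul_pow, mul_pow, ← mul_add, inv_pow, ← pow_mul, mul_comm k 2, pow_mul]
    have : 2 * Real.pi * (m ^ 2 * (θ ^ k + (θ ^ k)⁻¹)) = 1 := by rw [hm]; field_simp
    linear_combination ((r ^ 2) ^ k + ((r ^ 2) ^ k)⁻¹) * this

theorem integral_norm_sq_normalizedChebyshev_le {θ : ℝ} (hθ : 1 < θ) {r : ℝ} (hr : 1 ≤ r)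
    (hrθ : r ≤ √θ) (k : ℕ) :
    ∫ t in (0)..2 * Real.pi, ‖normalizedChebyshev θ k (joukowski (circleMap 0 r t))‖ ^ 2 ≤ 1 := by
  have hx : 0 < θ ^ k + (θ ^ k)⁻¹ := by positivity
  rw [integral_norm_sq_normalizedChebyshev (by linarith) (by linarith), div_le_one hx]
  have h1 : r ^ 2 ≤ θ := by
    rw [← Real.sq_sqrt (by linarith : 0 ≤ θ)]
    gcongr
  have h2 : (r ^ 2) ^ k ≤ θ ^ k := by gcongr
  rw [← not_lt, add_inv_lt_add_inv_iff (one_le_pow₀ hθ.le) (one_le_pow₀ (one_le_pow₀ hr)), not_lt]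
  exact h2

theorem norm_normalizedChebyshev_le {θ s : ℝ} (hθ : 0 < θ) (hs : 1 < s) {z : ℂ}
    (hz : z ∈ ellipse s) (k : ℕ) : ‖normalizedChebyshev θ k z‖ ≤ (√s / √θ) ^ k := by
  obtain ⟨w, hw, rfl⟩ := exists_joukowski_eq z
  have hws := ((joukowski_mem_ellipse_iff hs.le hw).1 hz).le
  have hw0 : w ≠ 0 := norm_pos_iff.1 (by linarith)
  have hm := joukowskiCoeff_pos hθ k
  have hR : 0 < √θ := Real.sqrt_pos.2 hθ
  have h1 : ‖w ^ k + (w ^ k)⁻¹‖ ≤ 2 * √s ^ k := by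
    refine (norm_add_le _ _).trans ?_
    rw [norm_inv, norm_pow]
    have h2 : (1 : ℝ) ≤ ‖w‖ ^ k := one_le_pow₀ hw
    have h3 : ‖w‖ ^ k ≤ √s ^ k := by gcongr
    have h4 : (‖w‖ ^ k)⁻¹ ≤ 1 := inv_le_one_of_one_le₀ h2
    linarith
  rw [normalizedChebyshev_joukowski θ k hw0, norm_mul, Complex.norm_real,
    Real.norm_of_nonneg hm.le, div_pow, le_div_iff₀ (by positivity)]
  calc joukowskiCoeff θ k * ‖w ^ k + (w ^ k)⁻¹‖ * √θ ^ k
      ≤ joukowskiCoeff θ k * (2 * √s ^ k) * √θ ^ k := by gcongr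
    _ = (2 * joukowskiCoeff θ k * √θ ^ k) * √s ^ k := by ring
    _ ≤ 1 * √s ^ k := by gcongr; exact joukowskiCoeff_mul_pow_le hθ k
    _ = _ := one_mul _

/-! ### Square summable Chebyshev series belong to the Szegő space -/

/-- The sum in the ellipse of the series of normalized Chebyshev polynomials with coefficients `a`,
extended by zero. -/
noncomputable def chebyshevSeries (θ : ℝ) (a : ℕ → ℂ) : ℂ → ℂ :=
  (ellipse θ).indicator fun z => ∑' k, a k * normalizedChebyshev θ k z

theorem exists_mem_smaller_ellipse {θ : ℝ} (hθ : 1 < θ) {z : ℂ} (hz : z ∈ ellipse θ) :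
    ∃ s, 1 < s ∧ s < θ ∧ z ∈ ellipse s := by
  obtain ⟨w, hw, rfl⟩ := exists_joukowski_eq z
  have h := (joukowski_mem_ellipse_iff hθ.le hw).1 hz
  obtain ⟨r, h1, h2⟩ := exists_between h
  have hr : 1 < r := by linarith
  have hsq : √(r ^ 2) = r := Real.sqrt_sq (by linarith)
  refine ⟨r ^ 2, by nlinarith, ?_, ?_⟩
  · rwa [← Real.lt_sqrt (by linarith)]
  · rw [joukowski_mem_ellipse_iff (by nlinarith) hw, hsq]
    exact h1

theorem norm_le_of_summable_sq {a : ℕ → ℂ} (ha : Summable fun k => ‖a k‖ ^ 2) (k : ℕ) :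
    ‖a k‖ ≤ 1 + ∑' j, ‖a j‖ ^ 2 := by
  have := ha.le_tsum k fun j _ => by positivity
  nlinarith [sq_nonneg (‖a k‖ - 1)]

theorem norm_chebyshevSeries_term_le {θ s : ℝ} (hθ : 0 < θ) (hs : 1 < s) {a : ℕ → ℂ}
    (ha : Summable fun k => ‖a k‖ ^ 2) (k : ℕ) {z : ℂ} (hz : z ∈ ellipse s) :
    ‖a k * normalizedChebyshev θ k z‖ ≤ (1 + ∑' j, ‖a j‖ ^ 2) * (√s / √θ) ^ k := by
  rw [norm_mul]
  exact mul_le_mul (norm_le_of_summable_sq ha k) (norm_normalizedChebyshev_le hθ hs hz k)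
    (norm_nonneg _) ((norm_nonneg _).trans (norm_le_of_summable_sq ha k))

theorem summable_chebyshevSeries_bound {θ s : ℝ} (hs : 1 < s) (hsθ : s < θ) (C : ℝ) :
    Summable fun k : ℕ => C * (√s / √θ) ^ k := by
  refine (summable_geometric_of_lt_one (by positivity) ?_).mul_left C
  rw [div_lt_one (Real.sqrt_pos.2 (by linarith))]
  exact Real.sqrt_lt_sqrt (by linarith) hsθ

theorem summable_chebyshevSeries {θ : ℝ} (hθ : 1 < θ) {a : ℕ → ℂ}
    (ha : Summable fun k => ‖a k‖ ^ 2) {z : ℂ} (hz : z ∈ ellipse θ) :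
    Summable fun k => a k * normalizedChebyshev θ k z := by
  obtain ⟨s, h1, h2, h3⟩ := exists_mem_smaller_ellipse hθ hz
  exact Summable.of_norm_bounded (summable_chebyshevSeries_bound h1 h2 _) fun k =>
    norm_chebyshevSeries_term_le (by linarith) h1 ha k h3

theorem hasSum_chebyshevSeries {θ : ℝ} (hθ : 1 < θ) {a : ℕ → ℂ}
    (ha : Summable fun k => ‖a k‖ ^ 2) {z : ℂ} (hz : z ∈ ellipse θ) :
    HasSum (fun k => a k * normalizedChebyshev θ k z) (chebyshevSeries θ a z) := by
  rw [chebyshevSeries, indicator_of_mem hz]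
  exact (summable_chebyshevSeries hθ ha hz).hasSum

theorem differentiableOn_chebyshevSeries {θ : ℝ} (hθ : 1 < θ) {a : ℕ → ℂ}
    (ha : Summable fun k => ‖a k‖ ^ 2) : DifferentiableOn ℂ (chebyshevSeries θ a) (ellipse θ) := by
  intro z hz
  obtain ⟨s, h1, h2, h3⟩ := exists_mem_smaller_ellipse hθ hz
  have h := Complex.differentiableOn_tsum_of_summable_norm
    (summable_chebyshevSeries_bound h1 h2 (1 + ∑' j, ‖a j‖ ^ 2))
    (F := fun k z => a k * normalizedChebyshev θ k z)
    (fun k => ((differentiable_normalizedChebyshev θ k).const_mul _).differentiableOn)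
    (isOpen_ellipse s) fun k w hw => norm_chebyshevSeries_term_le (by linarith) h1 ha k hw
  refine ((h.differentiableAt ((isOpen_ellipse s).mem_nhds h3)).congr_of_eventuallyEq
    ?_).differentiableWithinAt
  filter_upwards [(isOpen_ellipse θ).mem_nhds hz] with w hw
  rw [chebyshevSeries, indicator_of_mem hw]

theorem measurable_of_differentiableOn_ellipse {θ : ℝ} {f : ℂ → ℂ}
    (h0 : ∀ z, z ∉ ellipse θ → f z = 0) (hf : DifferentiableOn ℂ f (ellipse θ)) :
    Measurable f := by
  refine measurable_of_restrict_of_restrict_compl (measurableSet_ellipse θ) ?_ ?_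
  · exact (continuousOn_iff_continuous_domRestrict.1 hf.continuousOn).measurable
  · have : (ellipse θ)ᶜ.domRestrict f = fun _ => 0 := by
      ext z; exact h0 z z.2
    rw [this]
    exact measurable_const

theorem chebyshevSeries_of_notMem {θ : ℝ} (a : ℕ → ℂ) (z : ℂ) (hz : z ∉ ellipse θ) :
    chebyshevSeries θ a z = 0 :=
  indicator_of_notMem hz _

theorem joukowski_circleMap_mem_ellipse {θ : ℝ} (hθ : 1 < θ) {r : ℝ} (hr : 1 ≤ r) (hrθ : r < √θ)
    (t : ℝ) : joukowski (circleMap 0 r t) ∈ ellipse θ := by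
  have hn : ‖circleMap 0 r t‖ = r := norm_circleMap_zero_of_nonneg (by linarith) t
  exact (joukowski_mem_ellipse_iff hθ.le (by rwa [hn])).2 (by rwa [hn])

theorem lintegral_chebyshevSeries_le {θ : ℝ} (hθ : 1 < θ) {a : ℕ → ℂ}
    (ha : Summable fun k => ‖a k‖ ^ 2) {r : ℝ} (hr : 1 ≤ r) (hrθ : r < √θ) :
    ∫⁻ t in Ioc 0 (2 * Real.pi), ‖chebyshevSeries θ a (joukowski (circleMap 0 r t))‖ₑ ^ 2
      ≤ ENNReal.ofReal (∑' k, ‖a k‖ ^ 2) := by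
  have hr0 : 0 < r := by linarith
  refine lintegral_enorm_sq_le_of_hasSum
    (ψ := fun k t => a k * normalizedChebyshev θ k (joukowski (circleMap 0 r t)))
    (fun k => continuous_const.mul (continuous_normalizedChebyshev_joukowski θ k hr0))
    (fun j k hjk => ?_)
    (fun t => hasSum_chebyshevSeries hθ ha (joukowski_circleMap_mem_ellipse hθ hr hrθ t))
    fun s => ?_
  · simp only [map_mul]
    simp only [mul_mul_mul_comm _ _ (a k)]
    rw [intervalIntegral.integral_const_mul, integral_conj_normalizedChebyshev_mul θ hr0 hjk,
      mul_zero]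
  · refine le_trans (Finset.sum_le_sum fun k _ => ?_) (ha.sum_le_tsum s fun k _ => by positivity)
    simp only [norm_mul, mul_pow]
    rw [intervalIntegral.integral_const_mul]
    exact mul_le_of_le_one_right (by positivity)
      (integral_norm_sq_normalizedChebyshev_le hθ hr hrθ.le k)

theorem norm_deriv_ellipseParam_le {s θ : ℝ} (hs : 1 < s) (hsθ : s ≤ θ) (t : ℝ) :
    ‖deriv (ellipseParam s) t‖ ≤ √θ := by
  have hR := sqrt_gt_one hs
  have hn : ‖circleMap 0 (√s) t‖ = √s := norm_circleMap_zero_of_nonneg (by positivity) t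
  rw [(hasDerivAt_ellipseParam (by linarith) t).deriv, norm_div, norm_mul, Complex.norm_I, one_mul]
  have h1 : ‖circleMap 0 (√s) t - (circleMap 0 (√s) t)⁻¹‖ ≤ √s + (√s)⁻¹ := by
    refine (norm_sub_le _ _).trans ?_
    rw [norm_inv, hn]
  have h2 : (√s)⁻¹ ≤ 1 := inv_le_one_of_one_le₀ hR.le
  have h3 : √s ≤ √θ := Real.sqrt_le_sqrt hsθ
  have h4 : ‖(2 : ℂ)‖ = 2 := by simp
  rw [h4]
  linarith

theorem bounded_means_chebyshevSeries {θ : ℝ} (hθ : 1 < θ) {a : ℕ → ℂ}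
    (ha : Summable fun k => ‖a k‖ ^ 2) {s : ℝ} (hs : 1 < s) (hsθ : s < θ) :
    ∫⁻ z, ‖chebyshevSeries θ a z‖ₑ ^ 2 ∂(arcLength s)
      ≤ ENNReal.ofReal (√θ) * ENNReal.ofReal (∑' k, ‖a k‖ ^ 2) := by
  have hm := measurable_of_differentiableOn_ellipse (chebyshevSeries_of_notMem (θ := θ) a)
    (differentiableOn_chebyshevSeries hθ ha)
  rw [lintegral_arcLength s (by fun_prop)]
  calc _ ≤ ∫⁻ t in Ioc 0 (2 * Real.pi), ENNReal.ofReal (√θ) *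
        ‖chebyshevSeries θ a (joukowski (circleMap 0 (√s) t))‖ₑ ^ 2 := by
        refine lintegral_mono fun t => ?_
        rw [ellipseParam_eq (by linarith), ← ofReal_norm (deriv _ _)]
        gcongr
        exact norm_deriv_ellipseParam_le hs hsθ.le t
    _ = ENNReal.ofReal (√θ) * ∫⁻ t in Ioc 0 (2 * Real.pi),
        ‖chebyshevSeries θ a (joukowski (circleMap 0 (√s) t))‖ₑ ^ 2 :=
        lintegral_const_mul' _ _ ENNReal.ofReal_ne_top
    _ ≤ _ := by
        gcongr
        exact lintegral_chebyshevSeries_le hθ ha (sqrt_gt_one hs).le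
          (Real.sqrt_lt_sqrt (by linarith) hsθ)

theorem summable_sq_joukowskiCoeff {θ : ℝ} (hθ : 0 < θ) {a : ℕ → ℂ}
    (ha : Summable fun k => ‖a k‖ ^ 2) :
    Summable fun k => ‖a k * (joukowskiCoeff θ k * √θ ^ k : ℝ)‖ ^ 2 := by
  refine Summable.of_nonneg_of_le (fun k => by positivity) (fun k => ?_) ha
  have hm := joukowskiCoeff_pos hθ k
  have h1 := joukowskiCoeff_mul_pow_le hθ k
  have h2 : 0 ≤ joukowskiCoeff θ k * √θ ^ k := by positivity
  rw [norm_mul, Complex.norm_real, Real.norm_of_nonneg h2]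
  gcongr
  exact mul_le_of_le_one_right (norm_nonneg _) (by linarith)

theorem summable_powerSum {u : ℕ → ℂ} (hu : Summable fun k => ‖u k‖ ^ 2) {w : ℂ} (hw : ‖w‖ < 1) :
    Summable fun k => u k * w ^ k := by
  refine Summable.of_norm_bounded
    ((summable_geometric_of_lt_one (norm_nonneg w) hw).mul_left (1 + ∑' j, ‖u j‖ ^ 2)) fun k => ?_
  rw [norm_mul, norm_pow]
  exact mul_le_mul_of_nonneg_right (norm_le_of_summable_sq hu k) (by positivity)

/-- In the Joukowski parameter a Chebyshev series splits into a power series in `w` and one in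
`1 / w`. Square summable coefficients make the first a function of the Hardy space of the disc of
radius `√θ`; the second is holomorphic across the boundary circle. -/
theorem chebyshevSeries_joukowski {θ : ℝ} (hθ : 1 < θ) {a : ℕ → ℂ}
    (ha : Summable fun k => ‖a k‖ ^ 2) {w : ℂ} (hw : 1 ≤ ‖w‖) (hwθ : ‖w‖ < √θ) :
    chebyshevSeries θ a (joukowski w)
      = powerSum (fun k => a k * (joukowskiCoeff θ k * √θ ^ k : ℝ)) (w / √θ)
        + powerSum (fun k => a k * (joukowskiCoeff θ k * √θ ^ k : ℝ)) (w * √θ)⁻¹ := by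
  have hR := sqrt_gt_one hθ
  have hw0 : w ≠ 0 := norm_pos_iff.1 (by linarith)
  have hRc : (√θ : ℂ) ≠ 0 := by exact_mod_cast (by linarith : √θ ≠ 0)
  have hRn : ‖(√θ : ℂ)‖ = √θ := by rw [Complex.norm_real, Real.norm_of_nonneg (by positivity)]
  have hu := summable_sq_joukowskiCoeff (by linarith : 0 < θ) ha
  have h1 : ‖w / √θ‖ < 1 := by
    rw [norm_div, hRn, div_lt_one (by linarith)]
    exact hwθ
  have h2 : ‖(w * √θ)⁻¹‖ < 1 := by
    rw [norm_inv, norm_mul, hRn]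
    exact inv_lt_one_of_one_lt₀ (by nlinarith)
  refine (hasSum_chebyshevSeries hθ ha ((joukowski_mem_ellipse_iff hθ.le hw).2 hwθ)).unique ?_
  refine ((summable_powerSum hu h1).hasSum.add (summable_powerSum hu h2).hasSum).congr_fun ?_
  intro k
  rw [normalizedChebyshev_joukowski θ k hw0, div_pow, inv_pow, mul_pow]
  push_cast
  field_simp

theorem continuousAt_powerSum {u : ℕ → ℂ} (hu : Summable fun k => ‖u k‖ ^ 2) {w : ℂ}
    (hw : ‖w‖ < 1) : ContinuousAt (powerSum u) w := by
  have hwb : Metric.ball (0 : ℂ) 1 ∈ 𝓝 w := Metric.isOpen_ball.mem_nhds (by simpa using hw)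
  have h := ((diffContOnCl_powerSumPrimitive hu).1.deriv Metric.isOpen_ball).differentiableAt hwb
  refine h.continuousAt.congr ?_
  filter_upwards [hwb] with v hv
  exact deriv_powerSumPrimitive hu (by simpa using hv)

theorem ae_exists_tendsto_chebyshevSeries {θ : ℝ} (hθ : 1 < θ) {a : ℕ → ℂ}
    (ha : Summable fun k => ‖a k‖ ^ 2) :
    ∀ᵐ t ∂volume.restrict (Ioc 0 (2 * Real.pi)), ∃ l : ℂ,
      Tendsto (chebyshevSeries θ a) (nonTangential θ (ellipseParam θ t)) (𝓝 l) := by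
  have hR := sqrt_gt_one hθ
  have hRc : (√θ : ℂ) ≠ 0 := by exact_mod_cast (by linarith : √θ ≠ 0)
  have hRn : ‖(√θ : ℂ)‖ = √θ := by rw [Complex.norm_real, Real.norm_of_nonneg (by positivity)]
  have hu := summable_sq_joukowskiCoeff (by linarith : 0 < θ) ha
  filter_upwards [ae_exists_tendsto_powerSum hu] with t ⟨l, hl⟩
  set φ := powerSum (fun k => a k * (joukowskiCoeff θ k * √θ ^ k : ℝ)) with hφ
  set w₀ := circleMap 0 (√θ) t with hw₀
  have hn : ‖w₀‖ = √θ := norm_circleMap_zero_of_nonneg (by positivity) t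
  have hw0 : w₀ ≠ 0 := norm_pos_iff.1 (by linarith)
  have hdiv : w₀ / √θ = Complex.exp (t * Complex.I) := by
    rw [hw₀, circleMap_zero, mul_div_cancel_left₀ _ hRc]
  refine ⟨l + φ (w₀ * √θ)⁻¹, ?_⟩
  rw [ellipseParam_eq (by linarith)]
  refine tendsto_nonTangential_of_stolz hθ
    (fun w h1 h2 => chebyshevSeries_joukowski hθ ha h1 h2) hn fun K => Tendsto.add ?_ ?_
  · refine (hl K).comp (tendsto_nhdsWithin_iff.2 ⟨?_, ?_⟩)
    · rw [← hdiv]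
      have : Continuous fun w : ℂ => w / √θ := by fun_prop
      exact (this.tendsto w₀).mono_left nhdsWithin_le_nhds
    · filter_upwards [self_mem_nhdsWithin] with w ⟨_, h2, h3⟩
      refine ⟨?_, ?_⟩
      · rw [norm_div, hRn, div_lt_one (by linarith)]
        exact h2
      · rw [← hdiv, ← sub_div, norm_div, norm_div, hRn, div_le_iff₀ (by linarith)]
        refine h3.trans (le_of_eq ?_)
        field_simp
  · have h2 : ‖(w₀ * √θ)⁻¹‖ < 1 := by
      rw [norm_inv, norm_mul, hRn, hn]
      exact inv_lt_one_of_one_lt₀ (by nlinarith)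
    have hc : ContinuousAt (fun w : ℂ => (w * √θ)⁻¹) w₀ :=
      ContinuousAt.inv₀ (by fun_prop) (mul_ne_zero hw0 hRc)
    exact ((continuousAt_powerSum hu h2).tendsto.comp hc.tendsto).mono_left nhdsWithin_le_nhds

theorem ae_tendsto_boundaryValue {θ : ℝ} (hθ : 1 < θ) {f : ℂ → ℂ}
    (hf : ∀ᵐ t ∂volume.restrict (Ioc 0 (2 * Real.pi)), ∃ l : ℂ,
      Tendsto f (nonTangential θ (ellipseParam θ t)) (𝓝 l)) :
    ∀ᵐ t ∂volume.restrict (Ioc 0 (2 * Real.pi)),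
      Tendsto (fun r => f (joukowski (circleMap 0 r t))) (𝓝[<] √θ)
        (𝓝 (boundaryValue θ f (ellipseParam θ t))) := by
  filter_upwards [hf] with t ⟨l, hl⟩
  rw [boundaryValue_eq (ellipseParam_mem_frontier hθ t) hl]
  exact hl.comp (tendsto_joukowski_circleMap_nonTangential hθ t)

/-- The linear map of the plane that takes the boundary of the ellipse with parameter `θ` to that of
the confocal ellipse with parameter `s`, along the confocal hyperbolas. -/
noncomputable def confocalMap (θ s : ℝ) (z : ℂ) : ℂ :=
  ((√s + (√s)⁻¹) / (√θ + (√θ)⁻¹) * z.re : ℝ) +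
    ((√s - (√s)⁻¹) / (√θ - (√θ)⁻¹) * z.im : ℝ) * Complex.I

theorem continuous_confocalMap (θ s : ℝ) : Continuous (confocalMap θ s) := by
  unfold confocalMap; fun_prop

theorem confocalMap_ellipseParam {θ : ℝ} (hθ : 1 < θ) (s t : ℝ) :
    confocalMap θ s (ellipseParam θ t) = ellipseParam s t := by
  have hR := sqrt_gt_one hθ
  have h1 : √θ + (√θ)⁻¹ ≠ 0 := by positivity
  have h2 : √θ - (√θ)⁻¹ ≠ 0 := by
    have := inv_lt_one_of_one_lt₀ hR
    linarith
  have hre : (ellipseParam θ t).re = (√θ + (√θ)⁻¹) / 2 * Real.cos t := by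
    simp only [ellipseParam, Complex.add_re, Complex.ofReal_re, Complex.re_ofReal_mul, Complex.I_re]
    ring
  have him : (ellipseParam θ t).im = (√θ - (√θ)⁻¹) / 2 * Real.sin t := by
    simp only [ellipseParam, Complex.add_im, Complex.ofReal_im, Complex.im_ofReal_mul, Complex.I_im]
    ring
  have e1 : (√s + (√s)⁻¹) / (√θ + (√θ)⁻¹) * ((√θ + (√θ)⁻¹) / 2 * Real.cos t)
      = (√s + (√s)⁻¹) / 2 * Real.cos t := by
    rw [div_mul_eq_mul_div, div_eq_iff h1]; ring
  have e2 : (√s - (√s)⁻¹) / (√θ - (√θ)⁻¹) * ((√θ - (√θ)⁻¹) / 2 * Real.sin t)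
      = (√s - (√s)⁻¹) / 2 * Real.sin t := by
    rw [div_mul_eq_mul_div, div_eq_iff h2]; ring
  rw [confocalMap, hre, him, e1, e2, ellipseParam]

theorem exists_seq_tendsto_sqrt {θ : ℝ} (hθ : 1 < θ) :
    ∃ s : ℕ → ℝ, (∀ n, 1 < s n ∧ s n < θ) ∧ Tendsto (fun n => √(s n)) atTop (𝓝[<] √θ) := by
  obtain ⟨s, _, hs, hlim⟩ := exists_seq_strictMono_tendsto' hθ
  refine ⟨s, fun n => hs n, tendsto_nhdsWithin_iff.2
    ⟨(Real.continuous_sqrt.tendsto θ).comp hlim, Eventually.of_forall fun n => ?_⟩⟩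
  exact Real.sqrt_lt_sqrt (by linarith [(hs n).1]) (hs n).2

/-- The boundary function is the almost everywhere limit of the functions on the confocal ellipses,
pulled back by the confocal maps. -/
theorem aestronglyMeasurable_boundaryValue {θ : ℝ} (hθ : 1 < θ) {f : ℂ → ℂ} (hm : Measurable f)
    (hf : ∀ᵐ t ∂volume.restrict (Ioc 0 (2 * Real.pi)), ∃ l : ℂ,
      Tendsto f (nonTangential θ (ellipseParam θ t)) (𝓝 l)) :
    AEStronglyMeasurable (boundaryValue θ f) (arcLength θ) := by
  obtain ⟨s, hs, hlim⟩ := exists_seq_tendsto_sqrt hθ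
  refine aestronglyMeasurable_of_tendsto_ae atTop (f := fun n z => f (confocalMap θ (s n) z))
    (fun n => (hm.comp (continuous_confocalMap θ (s n)).measurable).aestronglyMeasurable)
    (ae_arcLength_of_ae hθ ?_)
  filter_upwards [ae_tendsto_boundaryValue hθ hf] with t ht
  refine (ht.comp hlim).congr fun n => ?_
  rw [Function.comp_apply, confocalMap_ellipseParam hθ,
    ellipseParam_eq (by linarith [(hs n).1])]

theorem lintegral_boundaryValue_chebyshevSeries_le {θ : ℝ} (hθ : 1 < θ) {a : ℕ → ℂ}
    (ha : Summable fun k => ‖a k‖ ^ 2) :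
    ∫⁻ z, ‖boundaryValue θ (chebyshevSeries θ a) z‖ₑ ^ 2 ∂(weightedArcLength θ chebyshevWeight)
      ≤ ENNReal.ofReal (∑' k, ‖a k‖ ^ 2) := by
  have hm := measurable_of_differentiableOn_ellipse (chebyshevSeries_of_notMem (θ := θ) a)
    (differentiableOn_chebyshevSeries hθ ha)
  have hlim := ae_exists_tendsto_chebyshevSeries hθ ha
  have hae := (aestronglyMeasurable_boundaryValue hθ hm hlim).mono_ac
    (weightedArcLength_ac θ chebyshevWeight)
  rw [weightedArcLength_eq_map hθ] at hae ⊢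
  rw [lintegral_map' (hae.enorm.pow_const 2) (continuous_ellipseParam θ).aemeasurable]
  obtain ⟨s, hs, hs'⟩ := exists_seq_tendsto_sqrt hθ
  calc ∫⁻ t in Ioc 0 (2 * Real.pi), ‖boundaryValue θ (chebyshevSeries θ a) (ellipseParam θ t)‖ₑ ^ 2
      = ∫⁻ t in Ioc 0 (2 * Real.pi), liminf (fun n =>
          ‖chebyshevSeries θ a (joukowski (circleMap 0 (√(s n)) t))‖ₑ ^ 2) atTop := by
        refine lintegral_congr_ae ?_
        filter_upwards [ae_tendsto_boundaryValue hθ hlim] with t ht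
        exact ((ENNReal.continuous_pow 2).continuousAt.tendsto.comp
          (ht.comp hs').enorm).liminf_eq.symm
    _ ≤ liminf (fun n => ∫⁻ t in Ioc 0 (2 * Real.pi),
          ‖chebyshevSeries θ a (joukowski (circleMap 0 (√(s n)) t))‖ₑ ^ 2) atTop := by
        refine lintegral_liminf_le fun n => ?_
        have : Measurable fun t => joukowski (circleMap 0 (√(s n)) t) := by
          unfold joukowski; fun_prop
        fun_prop
    _ ≤ _ := by
        refine liminf_le_of_le (by isBoundedDefault) fun b hb => ?_
        obtain ⟨n, hn⟩ := hb.exists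
        exact hn.trans (lintegral_chebyshevSeries_le hθ ha (sqrt_gt_one (hs n).1).le
          (Real.sqrt_lt_sqrt (by linarith [(hs n).1]) (hs n).2))

theorem isSzego_chebyshevSeries {θ : ℝ} (hθ : 1 < θ) {a : ℕ → ℂ}
    (ha : Summable fun k => ‖a k‖ ^ 2) : IsSzego θ chebyshevWeight (chebyshevSeries θ a) where
  eq_zero := chebyshevSeries_of_notMem a
  holomorphic := differentiableOn_chebyshevSeries hθ ha
  bounded_means := ⟨_, ENNReal.mul_lt_top ENNReal.ofReal_lt_top ENNReal.ofReal_lt_top,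
    fun _ hs hsθ => bounded_means_chebyshevSeries hθ ha hs hsθ⟩
  nonTangential_limit := ae_arcLength_of_ae hθ (ae_exists_tendsto_chebyshevSeries hθ ha)
  memLp := by
    have hm := measurable_of_differentiableOn_ellipse (chebyshevSeries_of_notMem (θ := θ) a)
      (differentiableOn_chebyshevSeries hθ ha)
    refine ⟨(aestronglyMeasurable_boundaryValue hθ hm
      (ae_exists_tendsto_chebyshevSeries hθ ha)).mono_ac (weightedArcLength_ac θ _), ?_⟩
    rw [eLpNorm_lt_top_iff_lintegral_rpow_enorm_lt_top two_ne_zero ENNReal.ofNat_ne_top]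
    simpa using (lintegral_boundaryValue_chebyshevSeries_le hθ ha).trans_lt ENNReal.ofReal_lt_top

/-! ### The Chebyshev expansion of a function of the Szegő space -/

section Expansion

instance fact_two_pi_pos : Fact (0 < 2 * Real.pi) := ⟨Real.two_pi_pos⟩

theorem coe_toCircle_two_pi (t : ℝ) :
    (AddCircle.toCircle (t : AddCircle (2 * Real.pi)) : ℂ) = Complex.exp (t * Complex.I) := by
  rw [AddCircle.toCircle_apply_mk, Circle.coe_exp]
  rw [div_self Real.two_pi_pos.ne', one_mul]

theorem fourier_coe_two_pi (n : ℤ) (t : ℝ) :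
    fourier n (t : AddCircle (2 * Real.pi)) = Complex.exp (n * t * Complex.I) := by
  rw [fourier_coe_apply]
  congr 1
  have : (Real.pi : ℂ) ≠ 0 := by exact_mod_cast Real.pi_ne_zero
  push_cast
  field_simp

/-- The `k`-th Laurent coefficient of `f ∘ joukowski`. -/
noncomputable def laurentCoeff (f : ℂ → ℂ) (k : ℤ) : ℂ :=
  (2 * Real.pi * Complex.I)⁻¹ * ∮ w in C(0, 1), w ^ (-k - 1) * f (joukowski w)

variable {θ : ℝ} {f : ℂ → ℂ}

theorem joukowski_mem_ellipse_of_annulus (hθ : 1 < θ) {w : ℂ} (h1 : (√θ)⁻¹ < ‖w‖)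
    (h2 : ‖w‖ < √θ) : joukowski w ∈ ellipse θ := by
  have hR := sqrt_gt_one hθ
  rcases le_total 1 ‖w‖ with h | h
  · exact (joukowski_mem_ellipse_iff hθ.le h).2 h2
  · have hw : 0 < ‖w‖ := lt_trans (by positivity) h1
    rw [← joukowski_inv]
    refine (joukowski_mem_ellipse_iff hθ.le ?_).2 ?_
    · rw [norm_inv]; exact (one_le_inv₀ hw).2 h
    · rw [norm_inv]; exact inv_lt_of_inv_lt₀ (by linarith) h1

theorem differentiableAt_comp_joukowski (hθ : 1 < θ) (hf : DifferentiableOn ℂ f (ellipse θ)) {w : ℂ}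
    (h1 : (√θ)⁻¹ < ‖w‖) (h2 : ‖w‖ < √θ) : DifferentiableAt ℂ (fun w => f (joukowski w)) w := by
  have hw : w ≠ 0 := norm_pos_iff.1 (lt_trans (by have := sqrt_gt_one hθ; positivity) h1)
  have hJ : DifferentiableAt ℂ joukowski w := by
    unfold joukowski
    exact (differentiableAt_id.add (differentiableAt_inv hw)).div_const 2
  exact DifferentiableAt.comp w (hf.differentiableAt ((isOpen_ellipse θ).mem_nhds
    (joukowski_mem_ellipse_of_annulus hθ h1 h2))) hJ

theorem continuous_comp_joukowski_toCircle (hθ : 1 < θ) (hf : DifferentiableOn ℂ f (ellipse θ))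
    {r : ℝ} (hr : 1 ≤ r) (hrθ : r < √θ) :
    Continuous fun x : AddCircle (2 * Real.pi) =>
      f (joukowski (r * (AddCircle.toCircle x : ℂ))) := by
  have hR := sqrt_gt_one hθ
  rw [continuous_iff_continuousAt]
  intro x
  have hn : ‖(r * (AddCircle.toCircle x : ℂ) : ℂ)‖ = r := by
    rw [norm_mul, Circle.norm_coe, mul_one, Complex.norm_real, Real.norm_of_nonneg (by linarith)]
  have h := (differentiableAt_comp_joukowski hθ hf (w := r * (AddCircle.toCircle x : ℂ))
    (by rw [hn]; exact (inv_lt_one_of_one_lt₀ hR).trans_le hr) (by rwa [hn])).continuousAt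
  have hc : Continuous fun x : AddCircle (2 * Real.pi) => (r * (AddCircle.toCircle x : ℂ) : ℂ) :=
    continuous_const.mul (continuous_induced_dom.comp AddCircle.continuous_toCircle)
  exact ContinuousAt.comp
    (f := fun x : AddCircle (2 * Real.pi) => (r * (AddCircle.toCircle x : ℂ) : ℂ))
    h hc.continuousAt

theorem circleIntegral_zpow_mul_comp_joukowski (hθ : 1 < θ) (hf : DifferentiableOn ℂ f (ellipse θ))
    {r : ℝ} (hr : 1 ≤ r) (hrθ : r < √θ) (k : ℤ) :
    (∮ w in C(0, r), w ^ k * f (joukowski w)) = ∮ w in C(0, 1), w ^ k * f (joukowski w) := by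
  have hR := sqrt_gt_one hθ
  have hd : ∀ w : ℂ, 1 ≤ ‖w‖ → ‖w‖ ≤ r →
      DifferentiableAt ℂ (fun w => w ^ k * f (joukowski w)) w := by
    intro w h1 h2
    have hw : w ≠ 0 := norm_pos_iff.1 (by linarith)
    exact (differentiableAt_zpow.2 (Or.inl hw)).mul (differentiableAt_comp_joukowski hθ hf
      ((inv_lt_one_of_one_lt₀ hR).trans_le h1) (by linarith))
  refine Complex.circleIntegral_eq_of_differentiable_on_annulus_off_countable zero_lt_one hr
    countable_empty (fun w hw => ?_) fun w hw => ?_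
  · refine (hd w ?_ ?_).continuousAt.continuousWithinAt
    · simpa using hw.2
    · simpa using hw.1
  · refine hd w ?_ ?_
    · have := hw.1.2
      simp only [Metric.mem_closedBall, dist_zero_right, not_le] at this
      exact this.le
    · have := hw.1.1
      simp only [Metric.mem_ball, dist_zero_right] at this
      exact this.le

theorem integral_exp_mul_comp_joukowski (hθ : 1 < θ) (hf : DifferentiableOn ℂ f (ellipse θ))
    {r : ℝ} (hr : 1 ≤ r) (hrθ : r < √θ) (k : ℤ) :
    (2 * Real.pi : ℂ)⁻¹ * ∫ t in (0)..2 * Real.pi,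
      Complex.exp ((-k : ℤ) * t * Complex.I) * f (joukowski (circleMap 0 r t))
      = r ^ k * laurentCoeff f k := by
  have hr0 : (r : ℂ) ≠ 0 := by exact_mod_cast (by linarith : r ≠ 0)
  rw [laurentCoeff, ← circleIntegral_zpow_mul_comp_joukowski hθ hf hr hrθ, circleIntegral]
  have e : ∀ t : ℝ, deriv (circleMap 0 r) t •
      (circleMap 0 r t ^ (-k - 1) * f (joukowski (circleMap 0 r t)))
      = (Complex.I * (r : ℂ) ^ (-k)) * (Complex.exp ((-k : ℤ) * t * Complex.I) *
        f (joukowski (circleMap 0 r t))) := by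
    intro t
    have hw : circleMap 0 r t ≠ 0 := by simpa [circleMap_zero] using hr0
    have e1 : Complex.exp ((-k : ℤ) * t * Complex.I) = Complex.exp (t * Complex.I) ^ (-k) := by
      rw [← Complex.exp_int_mul]
      ring_nf
    have e2 : circleMap 0 r t ^ (-k) = (r : ℂ) ^ (-k) * Complex.exp (t * Complex.I) ^ (-k) := by
      rw [circleMap_zero, mul_zpow]
    rw [deriv_circleMap, smul_eq_mul, e1, zpow_sub_one₀ hw, e2]
    field_simp
  simp only [e]
  rw [intervalIntegral.integral_const_mul, zpow_neg]
  generalize (∫ t in (0)..2 * Real.pi, Complex.exp ((-k : ℤ) * t * Complex.I) *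
    f (joukowski (circleMap 0 r t))) = A
  have h1 : (r : ℂ) ^ k ≠ 0 := zpow_ne_zero _ hr0
  have h2 := Complex.I_ne_zero
  have h3 : (Real.pi : ℂ) ≠ 0 := by exact_mod_cast Real.pi_ne_zero
  field_simp

theorem fourierCoeff_comp_joukowski (hθ : 1 < θ) (hf : DifferentiableOn ℂ f (ellipse θ))
    {r : ℝ} (hr : 1 ≤ r) (hrθ : r < √θ) (k : ℤ) :
    fourierCoeff (fun x : AddCircle (2 * Real.pi) =>
      f (joukowski (r * (AddCircle.toCircle x : ℂ)))) k = r ^ k * laurentCoeff f k := by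
  rw [← integral_exp_mul_comp_joukowski hθ hf hr hrθ, fourierCoeff_eq_intervalIntegral _ _ 0]
  simp only [fourier_coe_two_pi, coe_toCircle_two_pi, zero_add, smul_eq_mul, Complex.real_smul,
    circleMap_zero]
  push_cast
  ring

theorem laurentCoeff_neg (hθ : 1 < θ) (hf : DifferentiableOn ℂ f (ellipse θ)) (k : ℤ) :
    laurentCoeff f (-k) = laurentCoeff f k := by
  have h : ∀ k, laurentCoeff f k = fourierCoeff (fun x : AddCircle (2 * Real.pi) =>
      f (joukowski (((1 : ℝ) : ℂ) * (AddCircle.toCircle x : ℂ)))) k := fun k => by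
    rw [fourierCoeff_comp_joukowski hθ hf le_rfl (sqrt_gt_one hθ)]
    simp
  rw [h, h, fourierCoeff, fourierCoeff, ← integral_neg_eq_self]
  refine integral_congr_ae (ae_of_all _ fun x => ?_)
  simp only [Complex.ofReal_one, one_mul]
  rw [AddCircle.toCircle_neg, Circle.coe_inv, joukowski_inv]
  congr 1
  simp [fourier_apply]

theorem hasSum_sq_laurentCoeff (hθ : 1 < θ) (hf : DifferentiableOn ℂ f (ellipse θ))
    {r : ℝ} (hr : 1 ≤ r) (hrθ : r < √θ) :
    HasSum (fun k : ℤ => ‖(r : ℂ) ^ k * laurentCoeff f k‖ ^ 2)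
      ((2 * Real.pi)⁻¹ * ∫ t in (0)..2 * Real.pi, ‖f (joukowski (circleMap 0 r t))‖ ^ 2) := by
  have hc := continuous_comp_joukowski_toCircle hθ hf hr hrθ
  set g : C(AddCircle (2 * Real.pi), ℂ) := ⟨_, hc⟩ with hg
  have h := hasSum_sq_fourierCoeff
    (ContinuousMap.toLp (E := ℂ) 2 AddCircle.haarAddCircle ℂ g)
  have hint : ∫ x, ‖(ContinuousMap.toLp (E := ℂ) 2 AddCircle.haarAddCircle ℂ g) x‖ ^ 2
      ∂AddCircle.haarAddCircle
      = (2 * Real.pi)⁻¹ * ∫ t in (0)..2 * Real.pi, ‖f (joukowski (circleMap 0 r t))‖ ^ 2 := by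
    have e : ∫ x, ‖(ContinuousMap.toLp (E := ℂ) 2 AddCircle.haarAddCircle ℂ g) x‖ ^ 2
        ∂AddCircle.haarAddCircle = ∫ x, ‖g x‖ ^ 2 ∂AddCircle.haarAddCircle := by
      refine integral_congr_ae ?_
      filter_upwards [ContinuousMap.coeFn_toLp (E := ℂ) (p := 2) (𝕜 := ℂ)
        (AddCircle.haarAddCircle (T := 2 * Real.pi)) g] with x hx
      rw [hx]
    rw [e, AddCircle.integral_haarAddCircle, ← AddCircle.intervalIntegral_preimage _ 0, zero_add,
      smul_eq_mul]
    simp only [hg, ContinuousMap.coe_mk, coe_toCircle_two_pi, circleMap_zero]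
  rw [hint] at h
  refine h.congr_fun fun k => ?_
  rw [fourierCoeff_toLp, ← fourierCoeff_comp_joukowski hθ hf hr hrθ]
  rfl

/-- The Hardy-Smirnov condition bounds the mean squares in the Joukowski parameter, since the
density of arc length is bounded below away from the degenerate ellipse. -/
theorem integral_norm_sq_comp_joukowski_le {M : ENNReal} (hM : M < ⊤)
    (hθ : 1 < θ) (hf : DifferentiableOn ℂ f (ellipse θ)) (h0 : ∀ z, z ∉ ellipse θ → f z = 0)
    (hmeans : ∀ s : ℝ, 1 < s → s < θ → ∫⁻ z, ‖f z‖ₑ ^ 2 ∂(arcLength s) ≤ M)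
    {r₀ r : ℝ} (hr₀ : 1 < r₀) (hr : r₀ ≤ r) (hrθ : r < √θ) :
    ∫ t in (0)..2 * Real.pi, ‖f (joukowski (circleMap 0 r t))‖ ^ 2
      ≤ 2 / (r₀ - r₀⁻¹) * M.toReal := by
  have hm := measurable_of_differentiableOn_ellipse h0 hf
  have hr0 : 0 < r := by linarith
  have hsq : √(r ^ 2) = r := Real.sqrt_sq hr0.le
  have hc : 0 < r₀ - r₀⁻¹ := by
    have := inv_lt_one_of_one_lt₀ hr₀
    linarith
  have hcont : Continuous fun t => f (joukowski (circleMap 0 r t)) := by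
    have h := (continuous_comp_joukowski_toCircle hθ hf (by linarith : 1 ≤ r) hrθ).comp
      (AddCircle.continuous_mk' (2 * Real.pi))
    refine h.congr fun t => ?_
    rw [Function.comp_apply, circleMap_zero, ← coe_toCircle_two_pi]
    rfl
  have h1 := hmeans (r ^ 2) (by nlinarith) (by rwa [← Real.lt_sqrt hr0.le])
  rw [lintegral_arcLength _ (by fun_prop)] at h1
  have hd : ∀ t, ENNReal.ofReal ((r₀ - r₀⁻¹) / 2) ≤ ‖deriv (ellipseParam (r ^ 2)) t‖ₑ := by
    intro t
    have hn : ‖circleMap 0 r t‖ = r := norm_circleMap_zero_of_nonneg hr0.le t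
    rw [← ofReal_norm, (hasDerivAt_ellipseParam (by positivity) t).deriv, hsq, norm_div, norm_mul,
      Complex.norm_I, one_mul]
    refine ENNReal.ofReal_le_ofReal ?_
    have h2 : r - r⁻¹ ≤ ‖circleMap 0 r t - (circleMap 0 r t)⁻¹‖ := by
      refine le_trans (le_of_eq ?_) (norm_sub_norm_le _ _)
      rw [norm_inv, hn]
    have h3 : r⁻¹ ≤ r₀⁻¹ := inv_anti₀ (by linarith) hr
    have h4 : ‖(2 : ℂ)‖ = 2 := by simp
    rw [h4]
    linarith
  have h2 : ENNReal.ofReal ((r₀ - r₀⁻¹) / 2) *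
      ∫⁻ t in Ioc 0 (2 * Real.pi), ‖f (joukowski (circleMap 0 r t))‖ₑ ^ 2 ≤ M := by
    rw [← lintegral_const_mul' _ _ ENNReal.ofReal_ne_top]
    refine (lintegral_mono fun t => ?_).trans h1
    rw [ellipseParam_eq (by positivity), hsq]
    gcongr
    exact hd t
  have e : ∀ t, ‖f (joukowski (circleMap 0 r t))‖ₑ ^ 2
      = ENNReal.ofReal (‖f (joukowski (circleMap 0 r t))‖ ^ 2) := fun t => by
    rw [ENNReal.ofReal_pow (norm_nonneg _), ofReal_norm]
  have hint : IntegrableOn (fun t => ‖f (joukowski (circleMap 0 r t))‖ ^ 2)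
      (Ioc 0 (2 * Real.pi)) := (hcont.norm.pow 2).integrableOn_Ioc
  simp only [e] at h2
  rw [← ofReal_integral_eq_lintegral_ofReal
    (f := fun t => ‖f (joukowski (circleMap 0 r t))‖ ^ 2) hint
    (ae_of_all _ fun t => by positivity), ← ENNReal.ofReal_mul (by positivity),
    ← intervalIntegral.integral_of_le Real.two_pi_pos.le] at h2
  have h3 := (ENNReal.ofReal_le_iff_le_toReal hM.ne).1 h2
  rw [div_mul_eq_mul_div, le_div_iff₀ hc]
  linarith

theorem summable_sq_laurentCoeff (hθ : 1 < θ) (hf : IsSzego θ chebyshevWeight f) :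
    Summable fun k : ℕ => ‖laurentCoeff f k‖ ^ 2 * θ ^ k := by
  have hR := sqrt_gt_one hθ
  obtain ⟨M, hM, hmeans⟩ := hf.bounded_means
  obtain ⟨r₀, h1, h2⟩ := exists_between hR
  set C : ℝ := (2 * Real.pi)⁻¹ * (2 / (r₀ - r₀⁻¹) * M.toReal) with hC
  have hb : ∀ s : Finset ℕ, ∀ r, r₀ ≤ r → r < √θ →
      ∑ k ∈ s, ‖laurentCoeff f k‖ ^ 2 * (r ^ 2) ^ k ≤ C := by
    intro s r hr hrθ
    have h := hasSum_sq_laurentCoeff hθ hf.holomorphic (by linarith : 1 ≤ r) hrθ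
    have h3 := sum_le_hasSum (s.map Nat.castEmbedding) (fun k _ => by positivity) h
    rw [Finset.sum_map] at h3
    have hpi := Real.pi_pos
    refine le_trans (le_of_eq ?_) (h3.trans (mul_le_mul_of_nonneg_left
      (integral_norm_sq_comp_joukowski_le hM hθ hf.holomorphic hf.eq_zero hmeans h1 hr hrθ)
      (by positivity)))
    refine Finset.sum_congr rfl fun k _ => ?_
    rw [Nat.castEmbedding_apply, norm_mul, norm_zpow, Complex.norm_real,
      Real.norm_of_nonneg (by linarith), mul_pow, zpow_natCast, ← pow_mul, ← pow_mul, mul_comm k 2,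
      mul_comm]
  refine summable_of_sum_le (c := C) (fun k => by positivity) fun s => ?_
  have hlim : Tendsto (fun r => ∑ k ∈ s, ‖laurentCoeff f k‖ ^ 2 * (r ^ 2) ^ k) (𝓝[<] √θ)
      (𝓝 (∑ k ∈ s, ‖laurentCoeff f k‖ ^ 2 * θ ^ k)) := by
    have hc : Continuous fun r : ℝ => ∑ k ∈ s, ‖laurentCoeff f k‖ ^ 2 * (r ^ 2) ^ k := by fun_prop
    have := (hc.tendsto (√θ)).mono_left (nhdsWithin_le_nhds (s := Iio √θ))
    simpa only [Real.sq_sqrt (by linarith : 0 ≤ θ)] using this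
  refine le_of_tendsto hlim ?_
  filter_upwards [Ioo_mem_nhdsLT h2] with r hr
  exact hb s r hr.1.le hr.2

theorem hasSum_laurentCoeff (hθ : 1 < θ) (hf : IsSzego θ chebyshevWeight f) {w : ℂ} (hw : 1 ≤ ‖w‖)
    (hwθ : ‖w‖ < √θ) : HasSum (fun k : ℤ => laurentCoeff f k * w ^ k) (f (joukowski w)) := by
  have hR := sqrt_gt_one hθ
  obtain ⟨t, ht⟩ := exists_circleMap_zero_eq w
  set r := ‖w‖ with hr
  have hr0 : 0 < r := by linarith
  have hc := continuous_comp_joukowski_toCircle hθ hf.holomorphic hw hwθ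
  set g : C(AddCircle (2 * Real.pi), ℂ) := ⟨_, hc⟩ with hg
  have hcoeff : ∀ k, fourierCoeff g k = r ^ k * laurentCoeff f k :=
    fourierCoeff_comp_joukowski hθ hf.holomorphic hw hwθ
  have hpos : Summable fun k : ℕ => ‖laurentCoeff f k‖ * r ^ k := by
    -- the coefficients are dominated by `√θ ^ (-k)`
    have hs := summable_sq_laurentCoeff hθ hf
    have hgeo : Summable fun k : ℕ => (r ^ 2 / θ) ^ k := by
      refine summable_geometric_of_lt_one (by positivity) ?_
      rw [div_lt_one (by linarith), ← Real.lt_sqrt hr0.le]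
      exact hwθ
    refine Summable.of_nonneg_of_le (fun k => by positivity) (fun k => ?_) (hs.add hgeo)
    have h3 : (√θ ^ k) ^ 2 = θ ^ k := by
      rw [← pow_mul, mul_comm, pow_mul, Real.sq_sqrt (by linarith)]
    have hx : (‖laurentCoeff f k‖ * √θ ^ k) * (r / √θ) ^ k = ‖laurentCoeff f k‖ * r ^ k := by
      rw [div_pow]; field_simp
    have hy : ‖laurentCoeff f k‖ ^ 2 * θ ^ k = (‖laurentCoeff f k‖ * √θ ^ k) ^ 2 := by
      rw [mul_pow, h3]
    have hz : (r ^ 2 / θ) ^ k = ((r / √θ) ^ k) ^ 2 := by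
      rw [← pow_mul, mul_comm k 2, pow_mul, div_pow, div_pow, div_pow, Real.sq_sqrt (by linarith)]
    rw [← hx, hy, hz]
    nlinarith [sq_nonneg (‖laurentCoeff f k‖ * √θ ^ k - (r / √θ) ^ k),
      sq_nonneg (‖laurentCoeff f k‖ * √θ ^ k), sq_nonneg ((r / √θ) ^ k)]
  have hsum : Summable (fourierCoeff g) := by
    refine Summable.of_nat_of_neg (Summable.of_norm_bounded hpos fun k => ?_)
      (Summable.of_norm_bounded hpos fun k => ?_)
    · rw [hcoeff, norm_mul, norm_zpow, Complex.norm_real, Real.norm_of_nonneg hr0.le, zpow_natCast,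
        mul_comm]
    · rw [hcoeff, laurentCoeff_neg hθ hf.holomorphic, norm_mul, norm_zpow, Complex.norm_real,
        Real.norm_of_nonneg hr0.le, zpow_neg, zpow_natCast, mul_comm]
      refine mul_le_mul_of_nonneg_left ?_ (norm_nonneg _)
      have : 1 ≤ r ^ k := one_le_pow₀ hw
      exact (inv_le_one_of_one_le₀ this).trans this
  have h := has_pointwise_sum_fourier_series_of_summable hsum (t : AddCircle (2 * Real.pi))
  have hgt : g (t : AddCircle (2 * Real.pi)) = f (joukowski w) := by
    rw [hg, ContinuousMap.coe_mk, coe_toCircle_two_pi, ← circleMap_zero, ht]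
  rw [hgt] at h
  refine h.congr_fun fun k => ?_
  have e : w ^ k = (r : ℂ) ^ k * Complex.exp (k * t * Complex.I) := by
    rw [← ht, circleMap_zero, mul_zpow, ← Complex.exp_int_mul]
    ring_nf
  rw [hcoeff, fourier_coe_two_pi, smul_eq_mul, e]
  ring

/-- Every function of the Szegő space is a Chebyshev series with square summable coefficients. -/
theorem exists_eq_chebyshevSeries (hθ : 1 < θ) (hf : IsSzego θ chebyshevWeight f) :
    ∃ a : ℕ → ℂ, (Summable fun k => ‖a k‖ ^ 2) ∧ f = chebyshevSeries θ a := by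
  have h0 : 0 < θ := by linarith
  have hpi := Real.pi_pos
  -- the constant term of the Laurent series appears only once, hence the factor `1 / 2`
  set a : ℕ → ℂ := fun k =>
    (if k = 0 then laurentCoeff f k / 2 else laurentCoeff f k) / joukowskiCoeff θ k with ha
  have hsum : Summable fun k => ‖a k‖ ^ 2 := by
    refine Summable.of_nonneg_of_le (fun k => by positivity) (fun k => ?_)
      ((summable_sq_laurentCoeff hθ hf).mul_left (8 * Real.pi))
    have hm := joukowskiCoeff_pos h0 k
    have hnum : ‖(if k = 0 then laurentCoeff f k / 2 else laurentCoeff f k)‖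
        ≤ ‖laurentCoeff f k‖ := by
      split_ifs
      · rw [norm_div, Complex.norm_ofNat]
        linarith [norm_nonneg (laurentCoeff f k)]
      · exact le_rfl
    have h1 : 1 ≤ joukowskiCoeff θ k ^ 2 * (8 * Real.pi * θ ^ k) := by
      have h2 := joukowskiCoeff_sq h0 k
      have h3 : 1 / (4 * Real.pi) ≤ joukowskiCoeff θ k ^ 2 * (θ ^ k + (θ ^ k)⁻¹) := by
        rw [h2]
        split_ifs
        · exact le_rfl
        · exact one_div_le_one_div_of_le (by positivity) (by linarith)
      have h4 : (1 : ℝ) ≤ θ ^ k := one_le_pow₀ hθ.le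
      have h5 : (θ ^ k)⁻¹ ≤ θ ^ k := (inv_le_one_of_one_le₀ h4).trans h4
      have h6 : joukowskiCoeff θ k ^ 2 * (θ ^ k + (θ ^ k)⁻¹)
          ≤ joukowskiCoeff θ k ^ 2 * (2 * θ ^ k) := by
        gcongr
        linarith
      rw [div_le_iff₀ (by positivity)] at h3
      nlinarith
    simp only [ha]
    rw [norm_div, Complex.norm_real, Real.norm_of_nonneg hm.le, div_pow,
      div_le_iff₀ (by positivity)]
    calc _ ≤ ‖laurentCoeff f k‖ ^ 2 := by gcongr
      _ ≤ ‖laurentCoeff f k‖ ^ 2 * (joukowskiCoeff θ k ^ 2 * (8 * Real.pi * θ ^ k)) :=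
        le_mul_of_one_le_right (by positivity) h1
      _ = _ := by ring
  refine ⟨a, hsum, funext fun z => ?_⟩
  by_cases hz : z ∈ ellipse θ
  swap
  · rw [hf.eq_zero z hz, chebyshevSeries_of_notMem a z hz]
  refine HasSum.unique ?_ (hasSum_chebyshevSeries hθ hsum hz)
  obtain ⟨w, hw, rfl⟩ := exists_joukowski_eq z
  have hwθ := (joukowski_mem_ellipse_iff hθ.le hw).1 hz
  have hw0 : w ≠ 0 := norm_pos_iff.1 (by linarith)
  have h := (hasSum_laurentCoeff hθ hf hw hwθ).nat_add_neg.sub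
    (hasSum_ite_eq 0 (laurentCoeff f 0))
  simp only [zpow_zero, mul_one, add_sub_cancel_right] at h
  refine h.congr_fun fun k => ?_
  have hm : (joukowskiCoeff θ k : ℂ) ≠ 0 := by exact_mod_cast (joukowskiCoeff_pos h0 k).ne'
  rw [normalizedChebyshev_joukowski θ k hw0, laurentCoeff_neg hθ hf.holomorphic, zpow_neg,
    zpow_natCast]
  simp only [ha]
  split_ifs with hk
  · subst hk
    field_simp
    simp
    ring
  · field_simp
    ring

end Expansion

/-! ### The isometry from square summable sequences onto the Szegő space -/

/-- The Hilbert space of square summable complex sequences. -/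
abbrev SqSummable : Type := lp (fun _ : ℕ => ℂ) 2

theorem SqSummable.hasSum (a : SqSummable) : HasSum (fun k => ‖a k‖ ^ 2) (‖a‖ ^ 2) := by
  have := lp.hasSum_norm (p := 2) (by norm_num) a
  simpa using this

theorem norm_sq_szego {θ : ℝ} {ρ : ℂ → ℝ} (f : SzegoSpace θ ρ) :
    ‖f‖ ^ 2 = ∫ z, ‖f.trace z‖ ^ 2 ∂(weightedArcLength θ ρ) := by
  have h1 : inner ℂ f f = ∫ z, starRingEnd ℂ (f.trace z) * f.trace z ∂(weightedArcLength θ ρ) := rfl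
  have h2 : ∀ z, starRingEnd ℂ (f.trace z) * f.trace z = ((‖f.trace z‖ ^ 2 : ℝ) : ℂ) := fun z => by
    rw [Complex.conj_mul']; push_cast; rfl
  simp only [h2] at h1
  rw [integral_complex_ofReal] at h1
  rw [@norm_sq_eq_re_inner ℂ, h1]
  exact Complex.ofReal_re _

/-- The map that takes a square summable sequence to its Chebyshev series. -/
noncomputable def chebyshevSynthesis {θ : ℝ} (hθ : 1 < θ) :
    SqSummable →ₗ[ℂ] SzegoSpace θ chebyshevWeight where
  toFun a := Subtype.mk (chebyshevSeries θ a) (isSzego_chebyshevSeries hθ a.hasSum.summable)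
  map_add' a b := by
    refine Subtype.ext (funext fun z => ?_)
    change chebyshevSeries θ (a + b : SqSummable) z = chebyshevSeries θ a z + chebyshevSeries θ b z
    by_cases hz : z ∈ ellipse θ
    · refine (hasSum_chebyshevSeries hθ (a + b).hasSum.summable hz).unique ?_
      refine ((hasSum_chebyshevSeries hθ a.hasSum.summable hz).add
        (hasSum_chebyshevSeries hθ b.hasSum.summable hz)).congr_fun fun k => ?_
      rw [lp.coeFn_add, Pi.add_apply, add_mul]
    · simp only [chebyshevSeries_of_notMem _ z hz, add_zero]
  map_smul' c a := by
    refine Subtype.ext (funext fun z => ?_)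
    change chebyshevSeries θ (c • a : SqSummable) z = c * chebyshevSeries θ a z
    by_cases hz : z ∈ ellipse θ
    · refine (hasSum_chebyshevSeries hθ (c • a).hasSum.summable hz).unique ?_
      refine ((hasSum_chebyshevSeries hθ a.hasSum.summable hz).mul_left c).congr_fun fun k => ?_
      rw [lp.coeFn_smul, Pi.smul_apply, smul_eq_mul, mul_assoc]
    · simp only [chebyshevSeries_of_notMem _ z hz, mul_zero]

variable {θ : ℝ} (hθ : 1 < θ)

theorem toFun_chebyshevSynthesis (a : SqSummable) :
    (chebyshevSynthesis hθ a).toFun = chebyshevSeries θ a := rfl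

theorem norm_chebyshevSynthesis_le (a : SqSummable) : ‖chebyshevSynthesis hθ a‖ ≤ ‖a‖ := by
  refine le_of_sq_le_sq ?_ (norm_nonneg _)
  have h := lintegral_boundaryValue_chebyshevSeries_le hθ a.hasSum.summable
  rw [a.hasSum.tsum_eq] at h
  have hm : AEStronglyMeasurable (chebyshevSynthesis hθ a).trace
    (weightedArcLength θ chebyshevWeight) := (chebyshevSynthesis hθ a).isSzego.memLp.1
  rw [norm_sq_szego, integral_eq_lintegral_of_nonneg_ae
    (f := fun z => ‖(chebyshevSynthesis hθ a).trace z‖ ^ 2) (ae_of_all _ fun z => by positivity)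
    (hm.norm.pow 2)]
  refine ENNReal.toReal_le_of_le_ofReal (by positivity) (le_trans (le_of_eq ?_) h)
  refine lintegral_congr fun z => ?_
  rw [ENNReal.ofReal_pow (norm_nonneg _), ofReal_norm]
  rfl

/-- The normalized Chebyshev polynomial as an element of the Szegő space. -/
noncomputable def chebyshevElement (k : ℕ) : SzegoSpace θ chebyshevWeight :=
  chebyshevSynthesis hθ (lp.single 2 k 1)

theorem toFun_chebyshevElement (k : ℕ) {z : ℂ} (hz : z ∈ ellipse θ) :
    (chebyshevElement hθ k).toFun z = normalizedChebyshev θ k z := by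
  rw [chebyshevElement, toFun_chebyshevSynthesis]
  refine (hasSum_chebyshevSeries hθ (SqSummable.hasSum _).summable hz).unique ?_
  have h := hasSum_ite_eq k (normalizedChebyshev θ k z)
  refine h.congr_fun fun j => ?_
  rw [lp.single_apply]
  split_ifs with hjk
  · subst hjk; simp
  · simp [hjk]

theorem trace_chebyshevElement (k : ℕ) {ζ : ℂ} (hζ : ζ ∈ frontier (ellipse θ)) :
    (chebyshevElement hθ k).trace ζ = normalizedChebyshev θ k ζ := by
  refine boundaryValue_eq hζ (tendsto_iSup.2 fun κ => ?_)
  refine (((continuous_normalizedChebyshev θ k).tendsto ζ).mono_left nhdsWithin_le_nhds).congr' ?_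
  filter_upwards [self_mem_nhdsWithin] with z hz
  exact (toFun_chebyshevElement hθ k hz.1).symm

theorem inner_chebyshevElement (j k : ℕ) :
    inner ℂ (chebyshevElement hθ j) (chebyshevElement hθ k)
      = ∫ t in (0)..2 * Real.pi,
        starRingEnd ℂ (normalizedChebyshev θ j (joukowski (circleMap 0 (√θ) t))) *
          normalizedChebyshev θ k (joukowski (circleMap 0 (√θ) t)) := by
  have h1 : inner ℂ (chebyshevElement hθ j) (chebyshevElement hθ k)
    = ∫ z, starRingEnd ℂ ((chebyshevElement hθ j).trace z) * (chebyshevElement hθ k).trace z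
      ∂(weightedArcLength θ chebyshevWeight) := rfl
  have hm := (SzegoSpace.integrable_inner (chebyshevElement hθ j)
    (chebyshevElement hθ k)).aestronglyMeasurable
  rw [weightedArcLength_eq_map hθ] at h1 hm
  rw [h1, integral_map (continuous_ellipseParam θ).aemeasurable hm,
    intervalIntegral.integral_of_le Real.two_pi_pos.le]
  refine integral_congr_ae (ae_of_all _ fun t => ?_)
  simp only
  rw [trace_chebyshevElement hθ j (ellipseParam_mem_frontier hθ t),
    trace_chebyshevElement hθ k (ellipseParam_mem_frontier hθ t), ellipseParam_eq (by linarith)]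

theorem orthonormal_chebyshevElement : Orthonormal ℂ (chebyshevElement hθ) := by
  have hR : 0 < √θ := Real.sqrt_pos.2 (by linarith)
  refine ⟨fun k => ?_, fun j k hjk => ?_⟩
  · have h : ‖chebyshevElement hθ k‖ ^ 2 = 1 := by
      have h2 : ∀ z : ℂ, starRingEnd ℂ z * z = ((‖z‖ ^ 2 : ℝ) : ℂ) := fun z => by
        rw [Complex.conj_mul']; push_cast; rfl
      rw [@norm_sq_eq_re_inner ℂ, inner_chebyshevElement]
      simp only [h2]
      rw [intervalIntegral.integral_ofReal,
        integral_norm_sq_normalizedChebyshev (by linarith) hR, Real.sq_sqrt (by linarith),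
        div_self (by positivity)]
      simp
    exact (pow_eq_one_iff_of_nonneg (norm_nonneg _) two_ne_zero).1 h
  · exact (inner_chebyshevElement hθ j k).trans <|
      integral_conj_normalizedChebyshev_mul θ hR hjk

theorem surjective_chebyshevSynthesis : Function.Surjective (chebyshevSynthesis hθ) := by
  intro f
  obtain ⟨a, ha, hfa⟩ := exists_eq_chebyshevSeries hθ f.isSzego
  have hmem : Memℓp a 2 := by
    refine memℓp_gen ?_
    simpa using ha
  exact ⟨⟨a, hmem⟩, Subtype.ext hfa.symm⟩

theorem hasSum_chebyshevElement (a : SqSummable) :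
    HasSum (fun k => a k • chebyshevElement hθ k) (chebyshevSynthesis hθ a) := by
  set T : SqSummable →L[ℂ] SzegoSpace θ chebyshevWeight :=
    (chebyshevSynthesis hθ).mkContinuous 1 fun a => by
      rw [one_mul]; exact norm_chebyshevSynthesis_le hθ a with hT
  refine (T.hasSum (lp.hasSum_single (p := 2) ENNReal.ofNat_ne_top a)).congr_fun fun k => ?_
  rw [chebyshevElement, ← map_smul, ← lp.single_smul, smul_eq_mul, mul_one]
  rfl

/-- The synthesis map is an isometry: it is continuous, and preserves the norm on the dense
subspace of finitely supported sequences because the Chebyshev polynomials are orthonormal. -/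
theorem norm_chebyshevSynthesis (a : SqSummable) : ‖chebyshevSynthesis hθ a‖ = ‖a‖ := by
  have h1 := (hasSum_chebyshevElement hθ a).norm.pow 2
  have h2 : ∀ s : Finset ℕ, ‖∑ k ∈ s, a k • chebyshevElement hθ k‖ ^ 2 = ∑ k ∈ s, ‖a k‖ ^ 2 := by
    intro s
    rw [@norm_sq_eq_re_inner ℂ, (orthonormal_chebyshevElement hθ).inner_sum]
    simp only [Complex.conj_mul', ← Complex.ofReal_pow, ← Complex.ofReal_sum]
    exact Complex.ofReal_re _
  simp only [h2] at h1
  exact (pow_left_inj₀ (norm_nonneg _) (norm_nonneg _) two_ne_zero).1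
    (tendsto_nhds_unique h1 a.hasSum)

end SzegoEllipse

theorem mainTheorem7 (θ : ℝ) (hθ : 1 < θ) :
    -- the norm and the inner product make the Szegő space a Hilbert space
    (∀ f : SzegoEllipse.SzegoSpace θ SzegoEllipse.chebyshevWeight, ‖f‖ = 0 → f = 0) ∧
    CompleteSpace (SzegoEllipse.SzegoSpace θ SzegoEllipse.chebyshevWeight) ∧
    -- the normalized Chebyshev polynomials belong to it, are orthonormal, and span a dense subspace
    ∃ e : ℕ → SzegoEllipse.SzegoSpace θ SzegoEllipse.chebyshevWeight,
      (∀ k : ℕ, ∀ z ∈ SzegoEllipse.ellipse θ,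
        (e k).toFun z =
          (((θ ^ k + (θ ^ k)⁻¹) ^ (-(1 / 2) : ℝ) : ℝ) : ℂ) *
            (SzegoEllipse.orthonormalChebyshev k).eval z) ∧
      Orthonormal ℂ e ∧
      (Submodule.span ℂ (Set.range e)).topologicalClosure = ⊤ := by
  have hiso : Isometry (SzegoEllipse.chebyshevSynthesis hθ) :=
    AddMonoidHomClass.isometry_of_norm _ (SzegoEllipse.norm_chebyshevSynthesis hθ)
  have hsurj := SzegoEllipse.surjective_chebyshevSynthesis hθ
  refine ⟨fun f hf => ?_, ?_, SzegoEllipse.chebyshevElement hθ,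
    fun k z hz => SzegoEllipse.toFun_chebyshevElement hθ k hz,
    SzegoEllipse.orthonormal_chebyshevElement hθ, ?_⟩
  · obtain ⟨a, rfl⟩ := hsurj f
    rw [SzegoEllipse.norm_chebyshevSynthesis, norm_eq_zero] at hf
    rw [hf, map_zero]
  · exact (hiso.isUniformInducing.completeSpace_congr hsurj).1 inferInstance
  · refine Submodule.eq_top_iff'.2 fun f => ?_
    obtain ⟨a, rfl⟩ := hsurj f
    exact mem_closure_of_tendsto (SzegoEllipse.hasSum_chebyshevElement hθ a)
      (Eventually.of_forall fun s => Submodule.sum_mem _ fun k _ =>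
        Submodule.smul_mem _ _ (Submodule.subset_span ⟨k, rfl⟩))
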